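/- Let $n\ge 0$ be an integer and let $\alpha,\beta\in\mathbb R$ be such that $\alpha,\beta,\alpha+\beta\notin\mathbb Z$. Let $$P_n^{(\alpha,\beta)}(z)=2^{-n}\sum_{k=0}^n\binom{n+\alpha}{n-k}\binom{n+\beta}{k}(z-1)^k(z+1)^{n-k}$$ be the Jacobi polynomial, where $\binom{x}{j}=x(x-1)\cdots(x-j+1)/j!$. For $m\in\mathbb Z$ let $\mathbb P_m$ be the set of complex polynomials of degree $\le m$ (with $\mathbb P_m=\emptyset$ if $m<0$, and $0\in\mathbb P_m$ if $m\ge 0$) and $\mathbb P_m^*$ the set of complex polynomials of degree exactly $m$ (in particular nonzero). $[c]$ denotes the largest integer $\le c$. All curves are locally rectifiable, i.e. parametrized by maps on $(0,1)$ that are absolutely continuous on compact subintervals: * $\Gamma_{-1}$ is an arbitrary curve in $\mathbb C\setminus(-\infty,1]$ from $-1+i0$ to $-1-i0$, that is, tending to $-1$ within the upper half-plane at its start and tending to $-1$ within the lower half-plane at its end (so it runs clockwise around $1$); * $\Gamma_{1}$ is an arbitrary curve in $\mathbb C\setminus[-1,+\infty)$ from $1-i0$ to $1+i0$, that is, tending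 to $1$ within the lower half-plane at its start and within the upper half-plane at its end (so it runs clockwise around $-1$); * $\Gamma_\infty$ is an arbitrary curve in $\mathbb C\setminus\big((-\infty,-1]\cup[1,+\infty)\big)$ from $+i\infty$ to $-i\infty$, that is, with imaginary part tending to $+\infty$ at its start and to $-\infty$ at its end. On each of these curves $w(t;a,b)$ denotes any branch of the multivalued function $(1-t)^a(t+1)^b=\exp[a\log(1-t)+b\log(t+1)]$ that is continuous on the curve without its endpoints. Integrals along these curves are understood as limits of the integrals over compact pieces of the curve as both ends of the piece tend, independently, to the ends of the curve; their convergence is part of each assertion. (i) If $n+\beta>-1$ and $k=\max\{0,[-\beta]\}$, then $$\int_{\Gamma_{-1}}q(t)\,P_n^{(\alpha,\beta)}(t)\,w(t;\alpha,k+\beta)\,dt\;\begin{cases}=0&\text{for all }q\in\mathbb P_{n-k-1},\\ \ne0&\text{for all }q\in\mathbb P^*_{n-k}.\end{cases}$$ (ii) If $n+\alpha>-1$ and $k=\max\{0,[-\alpha]\}$, then $$\int_{\Gamma_{1}}q(t)\,P_n^{(\alpha,\beta)}(t)\,w(t;k+\alpha,\beta)\,dt\;\begin{cases}=0&\text{for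 all }q\in\mathbb P_{n-k-1},\\ \ne0&\text{for all }q\in\mathbb P^*_{n-k}.\end{cases}$$ (iii) If $n+\alpha+\beta<-1$ and $m=\min\{n-1,[-(n+\alpha+\beta+1)]\}$, then $$\int_{\Gamma_\infty}q(t)\,P_n^{(\alpha,\beta)}(t)\,w(t;\alpha,\beta)\,dt=0\quad\text{for all }q\in\mathbb P_m.$$ If, additionally, $n+\alpha+\beta<-n-1$, then $$\int_{\Gamma_\infty}q(t)\,P_n^{(\alpha,\beta)}(t)\,w(t;\alpha,\beta)\,dt\;\begin{cases}=0&\text{for all }q\in\mathbb P_{n-1},\\ \ne0&\text{for all }q\in\mathbb P^*_{n}.\end{cases}$$ -/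

import Mathlib

open Set Filter Topology MeasureTheory Polynomial

/-- The Jacobi polynomial
`P_n^{(α,β)}(z) = 2^{-n} ∑_{k=0}^n C(n+α, n-k) C(n+β, k) (z-1)^k (z+1)^{n-k}`,
where `C(x, j) = x (x-1) ⋯ (x-j+1) / j!` is the generalized binomial coefficient. -/
noncomputable def jacobiPolynomial (n : ℕ) (α β : ℂ) : ℂ[X] :=
  C (((2 : ℂ) ^ n)⁻¹) * ∑ k ∈ Finset.range (n + 1),
    C (Ring.choose ((n : ℂ) + α) (n - k) * Ring.choose ((n : ℂ) + β) k) *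
      (X - 1) ^ k * (X + 1) ^ (n - k)

/-- Complex polynomials of degree at most `m`; empty for `m < 0`. -/
def polysDegreeLE (m : ℤ) : Set ℂ[X] := {q | 0 ≤ m ∧ (q.natDegree : ℤ) ≤ m}

/-- Complex polynomials of degree exactly `m` (the zero polynomial is never one of them). -/
def polysDegreeEq (m : ℤ) : Set ℂ[X] := {q | q ≠ 0 ∧ (q.natDegree : ℤ) = m}

/-- `W` is, on the set `S`, a continuous branch of the multivalued function
`w(z; α, β) = (1 - z)^α (z + 1)^β = exp (α log (1 - z) + β log (z + 1))`: it is continuous on `S`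
and each of its values there is one of the values of that multivalued function. -/
def IsWeightBranch (α β : ℂ) (S : Set ℂ) (W : ℂ → ℂ) : Prop :=
  ContinuousOn W S ∧ ∀ z ∈ S, ∃ a b : ℂ,
    Complex.exp a = 1 - z ∧ Complex.exp b = z + 1 ∧ W z = Complex.exp (α * a + β * b)

/-- The curve `γ`, parametrized over the open interval `(0, 1)`, is absolutely continuous on every
compact subinterval. Every locally rectifiable curve, in particular every piecewise continuously
differentiable one, has such a parametrization. -/
def IsLocallyAC (γ : ℝ → ℂ) : Prop :=
  ∀ a b : ℝ, 0 < a → a ≤ b → b < 1 → AbsolutelyContinuousOnInterval γ a b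

/-- A curve in `ℂ ∖ (-∞, 1]` that starts at `-1 + i0` (it tends to `-1` from within the upper half
plane) and ends at `-1 - i0` (it tends to `-1` from within the lower half plane). -/
structure IsGammaNegOne (γ : ℝ → ℂ) : Prop where
  locallyAC : IsLocallyAC γ
  avoids : ∀ s ∈ Ioo (0 : ℝ) 1, ¬ ((γ s).im = 0 ∧ (γ s).re ≤ 1)
  start : Tendsto γ (𝓝[>] 0) (𝓝[{z : ℂ | 0 < z.im}] (-1))
  finish : Tendsto γ (𝓝[<] 1) (𝓝[{z : ℂ | z.im < 0}] (-1))

/-- A curve in `ℂ ∖ [-1, ∞)` that starts at `1 - i0` (it tends to `1` from within the lower half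
plane) and ends at `1 + i0` (it tends to `1` from within the upper half plane). -/
structure IsGammaOne (γ : ℝ → ℂ) : Prop where
  locallyAC : IsLocallyAC γ
  avoids : ∀ s ∈ Ioo (0 : ℝ) 1, ¬ ((γ s).im = 0 ∧ -1 ≤ (γ s).re)
  start : Tendsto γ (𝓝[>] 0) (𝓝[{z : ℂ | z.im < 0}] 1)
  finish : Tendsto γ (𝓝[<] 1) (𝓝[{z : ℂ | 0 < z.im}] 1)

/-- A curve in `ℂ ∖ ((-∞, -1] ∪ [1, ∞))` extending from `+i∞` to `-i∞`. -/
structure IsGammaInfty (γ : ℝ → ℂ) : Prop where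
  locallyAC : IsLocallyAC γ
  avoids : ∀ s ∈ Ioo (0 : ℝ) 1, ¬ ((γ s).im = 0 ∧ ((γ s).re ≤ -1 ∨ 1 ≤ (γ s).re))
  start : Tendsto (fun s => (γ s).im) (𝓝[>] 0) atTop
  finish : Tendsto (fun s => (γ s).im) (𝓝[<] 1) atBot

/-- The contour integral `∫_γ f(t) dt` converges and has the value `L`: the integral of `f` exists
(in the sense of Lebesgue) over each compact piece of the curve, and the integrals over the pieces
`a ≤ s ≤ b` tend to `L` as `a → 0+` and `b → 1-` independently. -/
def HasContourIntegral (γ : ℝ → ℂ) (f : ℂ → ℂ) (L : ℂ) : Prop :=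
  (∀ a b : ℝ, 0 < a → a ≤ b → b < 1 →
    IntervalIntegrable (fun s => f (γ s) * deriv γ s) volume a b) ∧
  Tendsto (fun p : ℝ × ℝ => ∫ s in p.1..p.2, f (γ s) * deriv γ s)
    ((𝓝[>] (0 : ℝ)) ×ˢ (𝓝[<] (1 : ℝ))) (𝓝 L)

/-! The Rodrigues mechanism drives everything: up to the factor `-2(n+1)`, `P_{n+1}^{(α,β)} w(α,β)`
is the derivative of `P_n^{(α+1,β+1)} w(α+1,β+1)` (`jacobiPolynomial_succ`). Integrating by parts
`n` times turns the integral of `q P_n w(α,β)` into `q.coeff n / 2^n` times the integral of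
`w(α+n,β+n)`, provided the boundary terms vanish (`exists_primitive_mul_jacobiPolynomial`). Degree
below `n` then gives zero, and degree `n` gives a nonzero value once the integral of the pure weight
is nonzero.

Contours enter only through their ends. On a cut plane everything has a holomorphic primitive, so an
integral is the jump of that primitive between two ends (`HasEndJump`), whatever the curve; any
continuous branch on the curve is a nonzero constant times a fixed holomorphic one.

For the jump between `+i∞` and `-i∞`, contiguity relations move an integer from one exponent to the
other at the cost of nonzero factors, until the exponents differ by at most one. On the imaginary
axis the weight then has positive real part, so the jump is not zero
(`exists_hasStripJump_ne_zero`). A Möbius map carries the loop at `-1` to this case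
(`exists_hasEndJump_raySlitPlane`), and the reflection `z ↦ -z` carries the loop at `1` to the loop
at `-1`. In (i), the factor `(t+1)^k` of the weight is moved into `q`, where it makes the boundary
terms vanish. -/

/-! ### Integration along locally absolutely continuous curves. -/

theorem AbsolutelyContinuousOnInterval.lipschitz_comp {X Y : Type*} [PseudoMetricSpace X]
    [PseudoMetricSpace Y] {f : ℝ → X} {g : X → Y} {a b : ℝ} {K : NNReal}
    (hf : AbsolutelyContinuousOnInterval f a b) (hg : LipschitzOnWith K g (f '' uIcc a b)) :
    AbsolutelyContinuousOnInterval (g ∘ f) a b := by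
  have h0 := Tendsto.const_mul (K : ℝ) hf
  rw [mul_zero] at h0
  refine squeeze_zero' (Eventually.of_forall fun E => Finset.sum_nonneg fun _ _ => dist_nonneg)
      ?_ h0
  filter_upwards [mem_inf_of_right (mem_principal_self _)] with E hE
  rw [Finset.mul_sum]
  refine Finset.sum_le_sum fun i hi => hg.dist_le_mul _ ?_ _ ?_
  · exact mem_image_of_mem _ (hE.1 i hi).1
  · exact mem_image_of_mem _ (hE.1 i hi).2

theorem AbsolutelyContinuousOnInterval.complex_re {f : ℝ → ℂ} {a b : ℝ}
    (hf : AbsolutelyContinuousOnInterval f a b) :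
    AbsolutelyContinuousOnInterval (fun s => (f s).re) a b :=
  hf.lipschitz_comp (g := Complex.re) (K := 1)
    (LipschitzWith.of_dist_le_mul fun x y => by
      simpa [Complex.dist_eq, Real.dist_eq] using Complex.abs_re_le_norm (x - y)).lipschitzOnWith

theorem AbsolutelyContinuousOnInterval.complex_im {f : ℝ → ℂ} {a b : ℝ}
    (hf : AbsolutelyContinuousOnInterval f a b) :
    AbsolutelyContinuousOnInterval (fun s => (f s).im) a b :=
  hf.lipschitz_comp (g := Complex.im) (K := 1)
    (LipschitzWith.of_dist_le_mul fun x y => by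
      simpa [Complex.dist_eq, Real.dist_eq] using Complex.abs_im_le_norm (x - y)).lipschitzOnWith

theorem AbsolutelyContinuousOnInterval.complex_ae_hasDerivAt {f : ℝ → ℂ} {a b : ℝ}
    (hf : AbsolutelyContinuousOnInterval f a b) :
    ∀ᵐ s : ℝ, s ∈ uIcc a b → HasDerivAt f
      (((deriv (fun s => (f s).re) s : ℝ) : ℂ) + ((deriv (fun s => (f s).im) s : ℝ) : ℂ)
          * Complex.I) s := by
  filter_upwards [hf.complex_re.ae_differentiableAt, hf.complex_im.ae_differentiableAt]
    with s h1 h2 hs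
  have h := (h1 hs).hasDerivAt.ofReal_comp.add ((h2 hs).hasDerivAt.ofReal_comp.mul_const Complex.I)
  refine h.congr_of_eventuallyEq (Eventually.of_forall fun t => ?_)
  simp [Complex.re_add_im]

theorem AbsolutelyContinuousOnInterval.complex_deriv_ae_eq {f : ℝ → ℂ} {a b : ℝ}
    (hf : AbsolutelyContinuousOnInterval f a b) :
    ∀ᵐ s : ℝ, s ∈ uIoc a b → ((deriv (fun s => (f s).re) s : ℝ) : ℂ) +
      ((deriv (fun s => (f s).im) s : ℝ) : ℂ) * Complex.I = deriv f s := by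
  filter_upwards [hf.complex_ae_hasDerivAt] with s hs h
  exact (hs (uIoc_subset_uIcc h)).deriv.symm

theorem IntervalIntegrable.complex_ofReal {f : ℝ → ℝ} {a b : ℝ} {μ : Measure ℝ}
    (hf : IntervalIntegrable f μ a b) : IntervalIntegrable (fun s => (f s : ℂ)) μ a b :=
  ⟨hf.1.ofReal, hf.2.ofReal⟩

theorem AbsolutelyContinuousOnInterval.complex_intervalIntegrable_deriv {f : ℝ → ℂ} {a b : ℝ}
    (hf : AbsolutelyContinuousOnInterval f a b) :
    IntervalIntegrable (deriv f) volume a b := by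
  refine IntervalIntegrable.congr_ae
    (hf.complex_re.intervalIntegrable_deriv.complex_ofReal.add
      (hf.complex_im.intervalIntegrable_deriv.complex_ofReal.mul_const Complex.I)) ?_
  rw [EventuallyEq, ae_restrict_iff' measurableSet_uIoc]
  exact hf.complex_deriv_ae_eq

theorem AbsolutelyContinuousOnInterval.complex_integral_deriv_eq_sub {f : ℝ → ℂ} {a b : ℝ}
    (hf : AbsolutelyContinuousOnInterval f a b) :
    ∫ s in a..b, deriv f s = f b - f a := by
  rw [← intervalIntegral.integral_congr_ae hf.complex_deriv_ae_eq,
    intervalIntegral.integral_add (hf.complex_re.intervalIntegrable_deriv.complex_ofReal)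
      (hf.complex_im.intervalIntegrable_deriv.complex_ofReal.mul_const _),
    intervalIntegral.integral_mul_const, intervalIntegral.integral_ofReal,
    intervalIntegral.integral_ofReal, hf.complex_re.integral_deriv_eq_sub,
    hf.complex_im.integral_deriv_eq_sub]
  apply Complex.ext <;> simp

/-- A holomorphic `F` is Lipschitz on the compact image of the curve, so `F ∘ γ` is again absolutely
continuous. The chain rule holds almost everywhere, and the fundamental theorem of calculus applies.
-/
theorem AbsolutelyContinuousOnInterval.integral_comp_mul_deriv {γ : ℝ → ℂ} {a b : ℝ}
    {U : Set ℂ} {F f : ℂ → ℂ} (hU : IsOpen U) (hγ : AbsolutelyContinuousOnInterval γ a b)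
    (hmem : ∀ s ∈ uIcc a b, γ s ∈ U) (hF : ∀ z ∈ U, HasDerivAt F (f z) z) :
    IntervalIntegrable (fun s => f (γ s) * deriv γ s) volume a b ∧
      ∫ s in a..b, f (γ s) * deriv γ s = F (γ b) - F (γ a) := by
  have hFd : DifferentiableOn ℂ F U := fun z hz => (hF z hz).differentiableAt.differentiableWithinAt
  have hfc : ContinuousOn f U :=
    (hFd.deriv hU).continuousOn.congr fun z hz => (hF z hz).deriv.symm
  have hlip : ∃ K, LipschitzOnWith K F (γ '' uIcc a b) := by
    refine LocallyLipschitzOn.exists_lipschitzOnWith_of_compact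
      (isCompact_uIcc.image_of_continuousOn hγ.continuousOn) ?_
    rintro _ ⟨s, hs, rfl⟩
    have hd : ContDiffAt ℂ 1 F (γ s) :=
      (hFd.analyticAt (hU.mem_nhds (hmem s hs))).contDiffAt
    obtain ⟨K, t, ht, hK⟩ := hd.exists_lipschitzOnWith
    exact ⟨K, t, mem_nhdsWithin_of_mem_nhds ht, hK⟩
  obtain ⟨K, hK⟩ := hlip
  have hac : AbsolutelyContinuousOnInterval (F ∘ γ) a b := hγ.lipschitz_comp hK
  have hder : ∀ᵐ s : ℝ, s ∈ uIoc a b → deriv (F ∘ γ) s = f (γ s) * deriv γ s := by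
    filter_upwards [hγ.complex_ae_hasDerivAt] with s hs h
    have hs' := hs (uIoc_subset_uIcc h)
    rw [hs'.deriv]
    exact ((hF _ (hmem s (uIoc_subset_uIcc h))).comp s hs').deriv
  refine ⟨?_, ?_⟩
  · refine hac.complex_intervalIntegrable_deriv.congr_ae ?_
    rw [EventuallyEq, ae_restrict_iff' measurableSet_uIoc]
    exact hder
  · rw [← intervalIntegral.integral_congr_ae hder, hac.complex_integral_deriv_eq_sub]
    rfl

theorem IsLocallyAC.continuousOn {γ : ℝ → ℂ} (hγ : IsLocallyAC γ) :
    ContinuousOn γ (Ioo 0 1) := by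
  intro s hs
  have h := (hγ (s / 2) ((s + 1) / 2) (by linarith [hs.1]) (by linarith [hs.1])
    (by linarith [hs.2])).continuousOn
  refine (h.continuousAt ?_).continuousWithinAt
  rw [uIcc_of_le (by linarith [hs.1])]
  exact Icc_mem_nhds (by linarith [hs.1]) (by linarith [hs.2])

/-- A primitive with limits along the two ends of the curve evaluates the contour integral. -/
theorem IsLocallyAC.hasContourIntegral {γ : ℝ → ℂ} (hγ : IsLocallyAC γ) {U : Set ℂ}
    {F f : ℂ → ℂ} {A B : ℂ} {l₁ l₂ : Filter ℂ} (hU : IsOpen U) (hmem : ∀ s ∈ Ioo (0 : ℝ) 1, γ s ∈ U)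
    (hF : ∀ z ∈ U, HasDerivAt F (f z) z) (h₁ : Tendsto γ (𝓝[>] 0) l₁) (h₂ : Tendsto γ (𝓝[<] 1) l₂)
    (hA : Tendsto F l₁ (𝓝 A)) (hB : Tendsto F l₂ (𝓝 B)) :
    HasContourIntegral γ f (B - A) := by
  have key : ∀ a b : ℝ, 0 < a → a ≤ b → b < 1 →
      IntervalIntegrable (fun s => f (γ s) * deriv γ s) volume a b ∧
      ∫ s in a..b, f (γ s) * deriv γ s = F (γ b) - F (γ a) := fun a b ha hab hb =>
    (hγ a b ha hab hb).integral_comp_mul_deriv hU (fun s hs => by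
      rw [uIcc_of_le hab] at hs
      exact hmem s ⟨ha.trans_le hs.1, hs.2.trans_lt hb⟩) hF
  refine ⟨fun a b ha hab hb => (key a b ha hab hb).1, ?_⟩
  have ht : Tendsto (fun p : ℝ × ℝ => F (γ p.2) - F (γ p.1))
      ((𝓝[>] (0 : ℝ)) ×ˢ (𝓝[<] (1 : ℝ))) (𝓝 (B - A)) :=
    ((hB.comp h₂).comp tendsto_snd).sub ((hA.comp h₁).comp tendsto_fst)
  refine ht.congr' ?_
  have e₁ : ∀ᶠ a in 𝓝[>] (0 : ℝ), 0 < a ∧ a < 1 / 2 := by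
    filter_upwards [Ioo_mem_nhdsGT (show (0 : ℝ) < 1 / 2 by norm_num)] with a ha using ha
  have e₂ : ∀ᶠ b in 𝓝[<] (1 : ℝ), 1 / 2 < b ∧ b < 1 := by
    filter_upwards [Ioo_mem_nhdsLT (show (1 / 2 : ℝ) < 1 by norm_num)] with a ha using ha
  filter_upwards [e₁.prod_mk e₂] with p hp
  exact (key p.1 p.2 hp.1.1 (by linarith [hp.1.2, hp.2.1]) hp.2.2).2.symm

theorem HasContourIntegral.congr {γ : ℝ → ℂ} {f g : ℂ → ℂ} {L : ℂ}
    (h : HasContourIntegral γ f L) (hfg : ∀ z ∈ γ '' Ioo 0 1, f z = g z) :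
    HasContourIntegral γ g L := by
  have e : ∀ a b : ℝ, 0 < a → a ≤ b → b < 1 →
      EqOn (fun s => f (γ s) * deriv γ s) (fun s => g (γ s) * deriv γ s) (uIcc a b) := by
    intro a b ha hab hb s hs
    rw [uIcc_of_le hab] at hs
    simp only
    rw [hfg _ (mem_image_of_mem _ ⟨ha.trans_le hs.1, hs.2.trans_lt hb⟩)]
  refine ⟨fun a b ha hab hb => (h.1 a b ha hab hb).congr ((e a b ha hab hb).mono
    uIoc_subset_uIcc), h.2.congr' ?_⟩
  have e₁ : ∀ᶠ a in 𝓝[>] (0 : ℝ), 0 < a ∧ a < 1 / 2 := by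
    filter_upwards [Ioo_mem_nhdsGT (show (0 : ℝ) < 1 / 2 by norm_num)] with a ha using ha
  have e₂ : ∀ᶠ b in 𝓝[<] (1 : ℝ), 1 / 2 < b ∧ b < 1 := by
    filter_upwards [Ioo_mem_nhdsLT (show (1 / 2 : ℝ) < 1 by norm_num)] with a ha using ha
  filter_upwards [e₁.prod_mk e₂] with p hp
  exact intervalIntegral.integral_congr
    (e p.1 p.2 hp.1.1 (by linarith [hp.1.2, hp.2.1]) hp.2.2)

/-- Integration along the point reflection of a curve. -/
theorem HasContourIntegral.of_neg {γ : ℝ → ℂ} {f : ℂ → ℂ} {L : ℂ}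
    (h : HasContourIntegral (fun s => -γ s) (fun z => f (-z)) L) :
    HasContourIntegral γ f (-L) := by
  have e : ∀ s, f (- -γ s) * deriv (fun s => -γ s) s = -(f (γ s) * deriv γ s) := fun s => by
    rw [deriv.fun_neg, neg_neg, mul_neg]
  obtain ⟨h1, h2⟩ := h
  simp only [e] at h1 h2
  refine ⟨fun a b ha hab hb => by
    have := (h1 a b ha hab hb).neg
    simpa only [Pi.neg_def, neg_neg] using this, ?_⟩
  simpa [intervalIntegral.integral_neg] using h2.neg

/-! ### Comparison of branches of the weight. -/

/-- Two branches of the weight differ by a nonzero constant factor on a connected set. -/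
theorem IsWeightBranch.exists_eq_const_mul {a b : ℂ} {S : Set ℂ} {W : ℂ → ℂ}
    (hW : IsWeightBranch a b S W) (hS : IsPreconnected S) {f g : ℂ → ℂ} (hf : ContinuousOn f S)
    (hg : ContinuousOn g S) (hfe : ∀ z ∈ S, Complex.exp (f z) = 1 - z)
    (hge : ∀ z ∈ S, Complex.exp (g z) = z + 1) :
    ∃ c : ℂ, c ≠ 0 ∧ ∀ z ∈ S, W z = c * Complex.exp (a * f z + b * g z) := by
  set E : ℂ → ℂ := fun z => Complex.exp (a * f z + b * g z) with hE
  set r : ℂ → ℂ := fun z => W z / E z with hr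
  have hE0 : ∀ z, E z ≠ 0 := fun z => Complex.exp_ne_zero _
  have hEc : ContinuousOn E S :=
    ((continuousOn_const.mul hf).add (continuousOn_const.mul hg)).cexp
  have hrc : ContinuousOn r S := hW.1.div hEc fun z _ => hE0 z
  set T : Set ℂ := range fun p : ℤ × ℤ => Complex.exp (a * (p.1 * (2 * Real.pi * Complex.I)) +
    b * (p.2 * (2 * Real.pi * Complex.I))) with hT
  have hmaps : r '' S ⊆ T := by
    rintro _ ⟨z, hz, rfl⟩
    obtain ⟨u, v, hu, hv, hWz⟩ := hW.2 z hz
    obtain ⟨m, hm⟩ := Complex.exp_eq_exp_iff_exists_int.1 (hu.trans (hfe z hz).symm)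
    obtain ⟨n, hn⟩ := Complex.exp_eq_exp_iff_exists_int.1 (hv.trans (hge z hz).symm)
    refine ⟨(m, n), ?_⟩
    simp only [hr, hE, hWz, hm, hn, ← Complex.exp_sub]
    congr 1
    ring
  -- The ratio is continuous on a connected set and takes values in the countable set `T`, so it is
  -- constant.
  have hss : (r '' S).Subsingleton :=
    (countable_range _).isTotallyDisconnected _ hmaps (hS.image r hrc)
  rcases S.eq_empty_or_nonempty with rfl | ⟨z₀, hz₀⟩
  · exact ⟨1, one_ne_zero, by simp⟩
  refine ⟨r z₀, ?_, fun z hz => ?_⟩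
  · obtain ⟨p, hp⟩ := hmaps (mem_image_of_mem r hz₀)
    rw [← hp]
    exact Complex.exp_ne_zero _
  · rw [hss (mem_image_of_mem r hz₀) (mem_image_of_mem r hz)]
    exact (div_mul_cancel₀ _ (hE0 z)).symm

/-! ### Jacobi polynomials: lowering relation, degree, reflection. -/

theorem Ring.succ_mul_choose_succ (x : ℂ) (k : ℕ) :
    ((k : ℂ) + 1) * Ring.choose x (k + 1) = (x - k) * Ring.choose x k := by
  have e : (descPochhammer ℤ (k + 1)).smeval x = (x - k) * (descPochhammer ℤ k).smeval x := by
    rw [descPochhammer_succ_right, mul_comm, smeval_mul]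
    simp [smeval_sub, smeval_natCast]
  rw [Ring.choose_eq_smul, Ring.choose_eq_smul, e, Nat.factorial_succ]
  have h1 : ((k : ℂ) + 1) ≠ 0 := by exact_mod_cast k.succ_ne_zero
  have h2 : ((k.factorial : ℕ) : ℂ) ≠ 0 := by exact_mod_cast k.factorial_ne_zero
  push_cast
  simp only [smul_eq_mul]
  field_simp

theorem derivative_sub_one_pow_mul_add_one_pow (k j : ℕ) :
    (X - 1) * (X + 1) * derivative (((X : ℂ[X]) - 1) ^ k * (X + 1) ^ j) =
      (C (k : ℂ) * (X + 1) + C (j : ℂ) * (X - 1)) * ((X - 1) ^ k * (X + 1) ^ j) := by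
  rw [derivative_mul, derivative_pow, derivative_pow]
  rcases k with _ | k <;> rcases j with _ | j <;> simp [pow_succ] <;> ring

/-- The homogeneous sum `∑ C(A, m-k) C(B, k) (X-1)^k (X+1)^{m-k}`. -/
noncomputable def jacobiAuxSum (A B : ℂ) (m : ℕ) : ℂ[X] :=
  ∑ k ∈ Finset.range (m + 1),
    C (Ring.choose A (m - k) * Ring.choose B k) * (X - 1) ^ k * (X + 1) ^ (m - k)

theorem jacobiPolynomial_eq (n : ℕ) (α β : ℂ) :
    jacobiPolynomial n α β = C (((2 : ℂ) ^ n)⁻¹) * jacobiAuxSum (n + α) (n + β) n := rfl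

/-- By Leibniz, the `m`-th derivative of `(z-1)^A (z+1)^B` is `m! (z-1)^(A-m) (z+1)^(B-m)` times
this sum. The identity is one further differentiation with the powers cleared. -/
theorem jacobiAuxSum_succ (A B : ℂ) (m : ℕ) :
    (X - 1) * (X + 1) * derivative (jacobiAuxSum A B m) +
      (C (A - m) * (X + 1) + C (B - m) * (X - 1)) * jacobiAuxSum A B m =
      C ((m : ℂ) + 1) * jacobiAuxSum A B (m + 1) := by
  set d : ℕ → ℂ[X] := fun k =>
    C (Ring.choose A (m + 1 - k) * Ring.choose B k) * (X - 1) ^ k * (X + 1) ^ (m + 1 - k) with hd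
  have hterm : ∀ k ∈ Finset.range (m + 1),
      (X - 1) * (X + 1) * derivative
        (C (Ring.choose A (m - k) * Ring.choose B k) * (X - 1) ^ k * (X + 1) ^ (m - k)) +
      (C (A - m) * (X + 1) + C (B - m) * (X - 1)) *
        (C (Ring.choose A (m - k) * Ring.choose B k) * (X - 1) ^ k * (X + 1) ^ (m - k)) =
      C ((m : ℂ) + 1 - k) * d k + C (((k + 1 : ℕ) : ℂ)) * d (k + 1) := by
    intro k hk
    obtain ⟨j, rfl⟩ := Nat.exists_eq_add_of_le (Nat.lt_succ_iff.1 (Finset.mem_range.1 hk))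
    have e1 : k + j - k = j := by omega
    have e2 : k + j + 1 - k = j + 1 := by omega
    have e3 : k + j + 1 - (k + 1) = j := by omega
    have h1 := congrArg (C : ℂ → ℂ[X]) (Ring.succ_mul_choose_succ A j)
    have h2 := congrArg (C : ℂ → ℂ[X]) (Ring.succ_mul_choose_succ B k)
    have h3 := derivative_sub_one_pow_mul_add_one_pow k j
    simp only [hd, e1, e2, e3]
    rw [mul_assoc (C _) _ _, derivative_C_mul]
    push_cast
    simp only [C_mul, C_add, C_sub, C_1] at h1 h2 h3 ⊢
    linear_combination (C (Ring.choose A j) * C (Ring.choose B k)) * h3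
      - C (Ring.choose B k) * (X - 1) ^ k * (X + 1) ^ (j + 1) * h1
      - C (Ring.choose A j) * (X - 1) ^ (k + 1) * (X + 1) ^ j * h2
  -- Each `d k` is collected with coefficient `m+1-k` from its own term and `k` from the preceding
  -- one, in total `m+1`. The extra terms at the two ends have coefficient zero.
  have hsum : C ((m : ℂ) + 1) * jacobiAuxSum A B (m + 1) =
      ∑ k ∈ Finset.range (m + 1),
          (C ((m : ℂ) + 1 - k) * d k + C (((k + 1 : ℕ) : ℂ)) * d (k + 1)) := by
    have s1 : ∑ k ∈ Finset.range (m + 2), C ((m : ℂ) + 1 - k) * d k =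
        ∑ k ∈ Finset.range (m + 1), C ((m : ℂ) + 1 - k) * d k := by
      rw [Finset.sum_range_succ]
      simp
    have s2 : ∑ k ∈ Finset.range (m + 2), C (k : ℂ) * d k =
        ∑ k ∈ Finset.range (m + 1), C (((k + 1 : ℕ) : ℂ)) * d (k + 1) := by
      rw [Finset.sum_range_succ']
      simp
    rw [Finset.sum_add_distrib, ← s1, ← s2, ← Finset.sum_add_distrib]
    unfold jacobiAuxSum
    rw [Finset.mul_sum]
    refine Finset.sum_congr rfl fun k _ => ?_
    rw [← add_mul, ← C_add, sub_add_cancel]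
  rw [hsum, ← Finset.sum_congr rfl hterm]
  unfold jacobiAuxSum
  rw [Finset.sum_add_distrib, derivative_sum, Finset.mul_sum, Finset.mul_sum]

/-- The lowering relation underlying the Rodrigues formula. -/
theorem jacobiPolynomial_succ (n : ℕ) (α β : ℂ) :
    (1 - X ^ 2) * derivative (jacobiPolynomial n (α + 1) (β + 1)) +
      (C (β + 1) * (1 - X) - C (α + 1) * (1 + X)) * jacobiPolynomial n (α + 1) (β + 1) =
      C (-2 * ((n : ℂ) + 1)) * jacobiPolynomial (n + 1) α β := by
  have h := jacobiAuxSum_succ (((n + 1 : ℕ) : ℂ) + α) (((n + 1 : ℕ) : ℂ) + β) n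
  -- Raising the parameters by one offsets lowering `n` by one, so both polynomials come from the
  -- same upper arguments `A`, `B`.
  have e1 : (n : ℂ) + (α + 1) = ((n + 1 : ℕ) : ℂ) + α := by push_cast; ring
  have e2 : (n : ℂ) + (β + 1) = ((n + 1 : ℕ) : ℂ) + β := by push_cast; ring
  have e3 : ((n + 1 : ℕ) : ℂ) + α - n = α + 1 := by push_cast; ring
  have e4 : ((n + 1 : ℕ) : ℂ) + β - n = β + 1 := by push_cast; ring
  have e5 : (C (-2 * ((n : ℂ) + 1)) : ℂ[X]) * C (((2 : ℂ) ^ (n + 1))⁻¹) =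
      - C (((2 : ℂ) ^ n)⁻¹) * C ((n : ℂ) + 1) := by
    rw [← C_neg, ← C_mul, ← C_mul]
    congr 1
    rw [pow_succ]
    field_simp
  rw [e3, e4] at h
  rw [jacobiPolynomial_eq, jacobiPolynomial_eq, e1, e2, derivative_C_mul, ← mul_assoc (C (-2 * _)),
    e5]
  linear_combination (-C (((2 : ℂ) ^ n)⁻¹)) * h

theorem jacobiPolynomial_zero (α β : ℂ) : jacobiPolynomial 0 α β = 1 := by
  simp [jacobiPolynomial]

theorem natDegree_jacobiPolynomial_le (n : ℕ) (α β : ℂ) :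
    (jacobiPolynomial n α β).natDegree ≤ n := by
  unfold jacobiPolynomial
  refine (natDegree_C_mul_le _ _).trans (natDegree_sum_le_of_forall_le _ _ fun k hk => ?_)
  have hk' := Nat.lt_succ_iff.1 (Finset.mem_range.1 hk)
  have h1 : ((X : ℂ[X]) - 1).natDegree = 1 := natDegree_X_sub_C (1 : ℂ)
  have h2 : ((X : ℂ[X]) + 1).natDegree = 1 := natDegree_X_add_C (1 : ℂ)
  have h3 : (((X : ℂ[X]) - 1) ^ k).natDegree ≤ k := by
    simp [h1]
  have h4 : (((X : ℂ[X]) + 1) ^ (n - k)).natDegree ≤ n - k := by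
    simp [h2]
  calc _ ≤ _ := natDegree_mul_le
    _ ≤ k + (n - k) := add_le_add ((natDegree_C_mul_le _ _).trans h3) h4
    _ = n := by omega

/-- Reversing the summation index exchanges the roles of `z - 1` and `z + 1`. This is the symmetry
that reduces (ii) to (i). -/
theorem jacobiPolynomial_eval_neg (n : ℕ) (α β z : ℂ) :
    (jacobiPolynomial n β α).eval (-z) = (-1) ^ n * (jacobiPolynomial n α β).eval z := by
  unfold jacobiPolynomial
  simp only [eval_mul, eval_finsetSum, eval_C, eval_pow, eval_sub, eval_add, eval_X, eval_one]
  rw [← mul_assoc, mul_comm ((-1 : ℂ) ^ n), mul_assoc]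
  congr 1
  rw [← Finset.sum_range_reflect, Finset.mul_sum]
  refine Finset.sum_congr rfl fun k hk => ?_
  have hk' := Nat.lt_succ_iff.1 (Finset.mem_range.1 hk)
  have e1 : n + 1 - 1 - k = n - k := by omega
  have e2 : n - (n - k) = k := by omega
  rw [e1, e2, show -z - 1 = (-1) * (z + 1) by ring, show -z + 1 = (-1) * (z - 1) by ring,
    mul_pow, mul_pow]
  have e3 : (-1 : ℂ) ^ n = (-1) ^ (n - k) * (-1) ^ k := by rw [← pow_add]; congr 1; omega
  rw [e3]
  ring

/-! ### The weight on a cut plane and repeated integration by parts. -/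

/-- Holomorphic branches `la`, `lb` of `log (1 - z)` and `log (z + 1)` on an open set. -/
structure IsLogPair (U : Set ℂ) (la lb : ℂ → ℂ) : Prop where
  isOpen : IsOpen U
  left_diff : DifferentiableOn ℂ la U
  right_diff : DifferentiableOn ℂ lb U
  left_exp : ∀ z ∈ U, Complex.exp (la z) = 1 - z
  right_exp : ∀ z ∈ U, Complex.exp (lb z) = z + 1

/-- The branch of `(1 - z) ^ a * (z + 1) ^ b` determined by two branches of the logarithm. -/
noncomputable def logWeight (la lb : ℂ → ℂ) (a b : ℝ) (z : ℂ) : ℂ :=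
  Complex.exp (a * la z + b * lb z)

theorem hasDerivAt_of_exp_eq {f g : ℂ → ℂ} {g' z : ℂ} {U : Set ℂ} (hU : IsOpen U) (hz : z ∈ U)
    (hf : DifferentiableOn ℂ f U) (h : ∀ z ∈ U, Complex.exp (f z) = g z)
    (hg : HasDerivAt g g' z) : HasDerivAt f (g' / g z) z := by
  have hfz := (hf.differentiableAt (hU.mem_nhds hz)).hasDerivAt
  have h1 : HasDerivAt g (Complex.exp (f z) * deriv f z) z :=
    hfz.cexp.congr_of_eventuallyEq (by
      filter_upwards [hU.mem_nhds hz] with w hw using (h w hw).symm)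
  have h2 := h1.unique hg
  have h3 : g z ≠ 0 := by rw [← h z hz]; exact Complex.exp_ne_zero _
  rw [← h2, h z hz, mul_div_cancel_left₀ _ h3]
  exact hfz

namespace IsLogPair

variable {U : Set ℂ} {la lb : ℂ → ℂ} {z : ℂ}

theorem one_sub_ne_zero (h : IsLogPair U la lb) (hz : z ∈ U) : 1 - z ≠ 0 := by
  rw [← h.left_exp z hz]; exact Complex.exp_ne_zero _

theorem add_one_ne_zero (h : IsLogPair U la lb) (hz : z ∈ U) : z + 1 ≠ 0 := by
  rw [← h.right_exp z hz]; exact Complex.exp_ne_zero _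

theorem logWeight_add_one_left (h : IsLogPair U la lb) (hz : z ∈ U) (a b : ℝ) :
    logWeight la lb (a + 1) b z = (1 - z) * logWeight la lb a b z := by
  rw [logWeight, logWeight, ← h.left_exp z hz, ← Complex.exp_add]
  congr 1
  push_cast
  ring

theorem logWeight_add_natCast_right (h : IsLogPair U la lb) (hz : z ∈ U) (a b : ℝ) (k : ℕ) :
    logWeight la lb a (b + k) z = (z + 1) ^ k * logWeight la lb a b z := by
  rw [logWeight, logWeight, ← h.right_exp z hz, ← Complex.exp_nat_mul, ← Complex.exp_add]
  congr 1
  push_cast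
  ring

theorem logWeight_add_one_right (h : IsLogPair U la lb) (hz : z ∈ U) (a b : ℝ) :
    logWeight la lb a (b + 1) z = (z + 1) * logWeight la lb a b z := by
  simpa using h.logWeight_add_natCast_right hz a b 1

theorem logWeight_add_one_add_one (h : IsLogPair U la lb) (hz : z ∈ U) (a b : ℝ) :
    logWeight la lb (a + 1) (b + 1) z = (1 - z) * (z + 1) * logWeight la lb a b z := by
  rw [h.logWeight_add_one_left hz, h.logWeight_add_one_right hz, mul_assoc]

/-- Since the exponents are real, the modulus does not depend on the branches. The estimates at
infinity and at `-1` rest on this. -/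
theorem norm_logWeight (h : IsLogPair U la lb) (hz : z ∈ U) (a b : ℝ) :
    ‖logWeight la lb a b z‖ = ‖1 - z‖ ^ a * ‖z + 1‖ ^ b := by
  rw [logWeight, Complex.norm_exp, ← h.left_exp z hz, ← h.right_exp z hz, Complex.norm_exp,
    Complex.norm_exp, ← Real.exp_mul, ← Real.exp_mul, ← Real.exp_add]
  congr 1
  simp [mul_comm]

theorem hasDerivAt_logWeight (h : IsLogPair U la lb) (hz : z ∈ U) (a b : ℝ) :
    HasDerivAt (logWeight la lb (a + 1) (b + 1))
      (((b + 1) * (1 - z) - (a + 1) * (1 + z)) * logWeight la lb a b z) z := by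
  have h1 := hasDerivAt_of_exp_eq h.isOpen hz h.left_diff h.left_exp ((hasDerivAt_id z).const_sub 1)
  have h2 := hasDerivAt_of_exp_eq h.isOpen hz h.right_diff h.right_exp
    ((hasDerivAt_id z).add_const 1)
  have h3 := ((h1.const_mul ((a + 1 : ℝ) : ℂ)).add (h2.const_mul ((b + 1 : ℝ) : ℂ))).cexp
  refine (h3.congr_deriv ?_)
  have e := h.logWeight_add_one_add_one hz a b
  rw [logWeight] at e
  simp only [Pi.add_apply]
  rw [e]
  have n1 := h.one_sub_ne_zero hz
  have n2 := h.add_one_ne_zero hz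
  field_simp
  push_cast
  ring

/-- Modulo a derivative, this trades `w(a,b)` for the faster decaying `w(a,b-1)`. -/
theorem hasDerivAt_logWeight_add_one_left (h : IsLogPair U la lb) (hz : z ∈ U) (a b : ℝ) :
    HasDerivAt (logWeight la lb (a + 1) b)
      (2 * b * logWeight la lb a (b - 1) z - (a + b + 1) * logWeight la lb a b z) z := by
  have h1 := h.hasDerivAt_logWeight hz a (b - 1)
  have h2 := h.logWeight_add_one_right hz a (b - 1)
  rw [sub_add_cancel] at h1 h2
  refine h1.congr_deriv ?_
  rw [h2]
  push_cast
  ring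

/-- This version relates two weights with the same exponent sum: modulo a derivative, one unit
passes between the exponents. -/
theorem hasDerivAt_logWeight_add_one_left' (h : IsLogPair U la lb) (hz : z ∈ U) (a b : ℝ) :
    HasDerivAt (logWeight la lb (a + 1) b)
      (b * logWeight la lb (a + 1) (b - 1) z - (a + 1) * logWeight la lb a b z) z := by
  have h1 := h.hasDerivAt_logWeight hz a (b - 1)
  have h2 := h.logWeight_add_one_right hz a (b - 1)
  have h3 := h.logWeight_add_one_left hz a (b - 1)
  rw [sub_add_cancel] at h1 h2
  refine h1.congr_deriv ?_
  rw [h2, h3]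
  push_cast
  ring

theorem differentiableOn_logWeight (h : IsLogPair U la lb) (a b : ℝ) :
    DifferentiableOn ℂ (logWeight la lb a b) U :=
  ((h.left_diff.const_mul _).add (h.right_diff.const_mul _)).cexp

/-- Repeated integration by parts: a primitive of `q P_n^{(α,β)} w(α,β)` which agrees, up to
terms that vanish at the ends, with a multiple of a primitive of `w(α+n,β+n)`. -/
theorem exists_primitive_mul_jacobiPolynomial (h : IsLogPair U la lb) (n : ℕ) :
    ∀ (α β : ℝ) (F : ℂ → ℂ) (q : ℂ[X]),
      (∀ z ∈ U, HasDerivAt F (logWeight la lb (α + n) (β + n) z) z) → q.natDegree ≤ n →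
      ∃ Φ : ℂ → ℂ,
        (∀ z ∈ U, HasDerivAt Φ
          (q.eval z * (jacobiPolynomial n α β).eval z * logWeight la lb α β z) z) ∧
        ∀ l : Filter ℂ, (∀ i j : ℕ, i + j + 1 = n → Tendsto (fun z => (derivative^[j] q).eval z *
            (jacobiPolynomial i ((α + j + 1 : ℝ) : ℂ) ((β + j + 1 : ℝ) : ℂ)).eval z *
            logWeight la lb (α + j + 1) (β + j + 1) z) l (𝓝 0)) →
          Tendsto (fun z => Φ z - q.coeff n / 2 ^ n * F z) l (𝓝 0) := by
  induction n with
  | zero =>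
    intro α β F q hF hq
    refine ⟨fun z => q.coeff 0 * F z, fun z hz => ?_, fun l _ => by simpa using tendsto_const_nhds⟩
    rw [eq_C_of_natDegree_le_zero hq, jacobiPolynomial_zero]
    simpa using (hF z hz).const_mul (q.coeff 0)
  | succ n ih =>
    intro α β F q hF hq
    have hn : ((n : ℂ) + 1) ≠ 0 := by exact_mod_cast n.succ_ne_zero
    -- Differentiating `q` and raising both parameters leaves `(α+n, β+n)` at the bottom of the
    -- recursion unchanged, so the same `F` serves throughout.
    obtain ⟨Ψ, hΨ, hΨl⟩ := ih (α + 1) (β + 1) F (derivative q)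
      (fun z hz => by
        have e1 : α + 1 + n = α + (n + 1 : ℕ) := by push_cast; ring
        have e2 : β + 1 + n = β + (n + 1 : ℕ) := by push_cast; ring
        rw [e1, e2]
        exact hF z hz)
      ((natDegree_derivative_le q).trans (by omega))
    set P := jacobiPolynomial n ((α + 1 : ℝ) : ℂ) ((β + 1 : ℝ) : ℂ) with hP
    -- The constant inverts the factor `-2(n+1)` of the lowering relation up to sign. The new
    -- primitive is one integration by parts, with `q P w(α+1,β+1)` as boundary term.
    set c : ℂ := (2 * ((n : ℂ) + 1))⁻¹ with hc
    refine ⟨fun z => c * Ψ z - c * (q.eval z * P.eval z * logWeight la lb (α + 1) (β + 1) z),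
      fun z hz => ?_, fun l hl => ?_⟩
    · have h1 := (((q.hasDerivAt z).mul (P.hasDerivAt z)).mul
        (h.hasDerivAt_logWeight hz α β)).const_mul c
      refine (((hΨ z hz).const_mul c).sub h1).congr_deriv ?_
      have h2 := congrArg (eval z) (jacobiPolynomial_succ n (α : ℂ) (β : ℂ))
      have e1 : jacobiPolynomial n ((α : ℂ) + 1) ((β : ℂ) + 1) = P := by
        rw [hP]; push_cast; rfl
      rw [e1] at h2
      simp only [eval_add, eval_sub, eval_mul, eval_C, eval_one, eval_X, eval_pow] at h2
      have h3 : c * (2 * ((n : ℂ) + 1)) = 1 := inv_mul_cancel₀ (by simpa using hn)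
      simp only [Pi.mul_apply]
      rw [h.logWeight_add_one_add_one hz]
      linear_combination (- c * eval z q * logWeight la lb α β z) * h2 +
        (eval z q * eval z (jacobiPolynomial (n + 1) α β) * logWeight la lb α β z) * h3
    · have h1 := hΨl l fun i j hij => by
        have := hl i (j + 1) (by omega)
        rw [Function.iterate_succ_apply] at this
        have e1 : α + (j + 1 : ℕ) + 1 = α + 1 + j + 1 := by push_cast; ring
        have e2 : β + (j + 1 : ℕ) + 1 = β + 1 + j + 1 := by push_cast; ring
        rwa [e1, e2] at this
      have h2 := hl n 0 (by omega)
      simp only [Nat.cast_zero, add_zero, Function.iterate_zero, id] at h2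
      have h3 := (h1.const_mul c).sub (h2.const_mul c)
      rw [mul_zero, sub_zero] at h3
      refine h3.congr fun z => ?_
      -- The `n`-th coefficient of `q'` carries a factor `n+1`, which `c` cancels, leaving one more
      -- factor `1/2`.
      rw [coeff_derivative, ← hP, hc]
      field_simp
      ring

end IsLogPair

/-! ### Primitives on star-shaped domains and limits at infinity. -/

/-- A holomorphic function on a star-convex open set has a primitive. -/
theorem exists_primitive_of_starConvex {U : Set ℂ} {f : ℂ → ℂ} (hU : IsOpen U)
    (h0 : StarConvex ℝ 0 U) (hf : DifferentiableOn ℂ f U) :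
    ∃ F : ℂ → ℂ, ∀ z ∈ U, HasDerivAt F (f z) z := by
  have hmem : ∀ z ∈ U, ∀ t ∈ Icc (0 : ℝ) 1, (t : ℂ) * z ∈ U := fun z hz t ht => by
    have := h0.smul_mem hz ht.1 ht.2
    rwa [Complex.real_smul] at this
  have hf' : ContinuousOn (deriv f) U := (hf.deriv hU).continuousOn
  -- The candidate is the integral of `f` along the segment from `0` to `z`.
  refine ⟨fun z => ∫ t in (0 : ℝ)..1, z * f (t * z), fun z₀ hz₀ => ?_⟩
  obtain ⟨r, hr, hball⟩ := Metric.nhds_basis_closedBall.mem_iff.1 (hU.mem_nhds hz₀)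
  set K : Set (ℝ × ℂ) := Icc (0 : ℝ) 1 ×ˢ Metric.closedBall z₀ r with hK
  have hKc : IsCompact K := isCompact_Icc.prod (isCompact_closedBall _ _)
  have hm : MapsTo (fun p : ℝ × ℂ => (p.1 : ℂ) * p.2) K U := fun p hp =>
    hmem _ (hball hp.2) _ hp.1
  have hmc : ContinuousOn (fun p : ℝ × ℂ => (p.1 : ℂ) * p.2) K := by fun_prop
  set G : ℂ → ℝ → ℂ := fun z t => f (t * z) + t * z * deriv f (t * z) with hG
  have hGc : ContinuousOn (fun p : ℝ × ℂ => G p.2 p.1) K :=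
    (hf.continuousOn.comp hmc hm).add (hmc.mul (hf'.comp hmc hm))
  obtain ⟨C, hC⟩ := hKc.exists_bound_of_continuousOn hGc
  have hline : ∀ z ∈ Metric.closedBall z₀ r,
      ContinuousOn (fun t : ℝ => ((t, z) : ℝ × ℂ)) (Icc 0 1) ∧
      MapsTo (fun t : ℝ => ((t, z) : ℝ × ℂ)) (Icc 0 1) K := fun z hz =>
    ⟨by fun_prop, fun t ht => ⟨ht, hz⟩⟩
  have hGt : ContinuousOn (G z₀) (uIcc 0 1) := by
    rw [uIcc_of_le zero_le_one]
    have := hline z₀ (Metric.mem_closedBall_self hr.le)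
    exact hGc.comp this.1 this.2
  have hint : ∀ z ∈ Metric.closedBall z₀ r, ContinuousOn (fun t : ℝ => z * f (t * z))
      (uIcc 0 1) := by
    intro z hz
    rw [uIcc_of_le zero_le_one]
    exact continuousOn_const.mul (((hf.continuousOn.comp hmc hm)).comp
        (hline z hz).1 (hline z hz).2)
  have hIoc : ∀ t, t ∈ uIoc (0 : ℝ) 1 → t ∈ Icc (0 : ℝ) 1 := fun t ht => by
    rw [uIoc_of_le zero_le_one] at ht
    exact Ioc_subset_Icc_self ht
  have key := intervalIntegral.hasDerivAt_integral_of_dominated_loc_of_deriv_le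
    (μ := volume) (a := 0) (b := 1) (F := fun z t => z * f (t * z)) (F' := G) (x₀ := z₀)
    (s := Metric.closedBall z₀ r) (bound := fun _ => C) (Metric.closedBall_mem_nhds _ hr)
    (by
      filter_upwards [Metric.closedBall_mem_nhds z₀ hr] with z hz
      exact (intervalIntegrable_iff.1 (hint z hz).intervalIntegrable).aestronglyMeasurable)
    (hint z₀ (Metric.mem_closedBall_self hr.le)).intervalIntegrable
    (intervalIntegrable_iff.1 hGt.intervalIntegrable).aestronglyMeasurable
    (Eventually.of_forall fun t ht z hz => hC (t, z) ⟨hIoc t ht, hz⟩)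
    intervalIntegrable_const
    (Eventually.of_forall fun t ht z hz => by
      have hd := (hf.differentiableAt (hU.mem_nhds (hmem z (hball hz) t (hIoc t ht)))).hasDerivAt
      have h1 := (hasDerivAt_id z).mul (hd.comp z ((hasDerivAt_id z).const_mul (t : ℂ)))
      refine h1.congr_deriv ?_
      simp only [hG, id, Function.comp]
      ring)
  refine key.2.congr_deriv ?_
  -- The `z`-derivative of the integrand is the `t`-derivative of `t f(t z₀)`, so it integrates to
  -- `f z₀`.
  have hprim : ∀ t ∈ uIcc (0 : ℝ) 1, HasDerivAt (fun t : ℝ => (t : ℂ) * f (t * z₀)) (G z₀ t) t := by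
    intro t ht
    rw [uIcc_of_le zero_le_one] at ht
    have hd := (hf.differentiableAt (hU.mem_nhds (hmem z₀ hz₀ t ht))).hasDerivAt
    have h0 : HasDerivAt (fun t : ℝ => (t : ℂ)) 1 t := (hasDerivAt_id t).ofReal_comp
    have h1 := h0.mul (hd.comp t (h0.mul_const z₀))
    refine h1.congr_deriv ?_
    simp only [hG, Function.comp]
    ring
  rw [intervalIntegral.integral_eq_sub_of_hasDerivAt hprim hGt.intervalIntegrable]
  simp

/-- Neighbourhoods of infinity within a half plane. -/
noncomputable def halfInfty (σ : ℝ) : Filter ℂ := Bornology.cobounded ℂ ⊓ 𝓟 {z | 0 < σ * z.im}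

theorem rpow_le_of_half_le_of_le_two_mul {x y : ℝ} (a : ℝ) (hx : 0 < x) (h1 : x / 2 ≤ y)
    (h2 : y ≤ 2 * x) : y ^ a ≤ 2 ^ |a| * x ^ a := by
  have hy : 0 < y := by linarith
  rcases le_total 0 a with h | h
  · rw [abs_of_nonneg h, ← Real.mul_rpow (by norm_num) hx.le]
    exact Real.rpow_le_rpow hy.le h2 h
  · rw [abs_of_nonpos h, Real.rpow_neg (by norm_num), ← Real.inv_rpow (by norm_num),
      ← Real.mul_rpow (by norm_num) hx.le]
    exact Real.rpow_le_rpow_of_nonpos (by positivity) (by linarith) h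

namespace IsLogPair

variable {U : Set ℂ} {la lb : ℂ → ℂ} {z : ℂ}

/-- Outside the disc of radius `2`, both `‖1 - z‖` and `‖z + 1‖` lie between `‖z‖/2` and `2‖z‖`. -/
theorem norm_logWeight_le (h : IsLogPair U la lb) (hz : z ∈ U) (hz2 : 2 ≤ ‖z‖) (a b : ℝ) :
    ‖logWeight la lb a b z‖ ≤ 2 ^ |a| * 2 ^ |b| * ‖z‖ ^ (a + b) := by
  have hz0 : 0 < ‖z‖ := by linarith
  have h1 := norm_sub_norm_le z 1
  have h2 := norm_sub_le (1 : ℂ) z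
  have h3 := norm_sub_le (z + 1) 1
  have h4 := norm_add_le z 1
  rw [norm_sub_rev] at h1
  rw [add_sub_cancel_right] at h3
  rw [norm_one] at h1 h2 h3 h4
  rw [h.norm_logWeight hz, Real.rpow_add hz0]
  calc _ ≤ (2 ^ |a| * ‖z‖ ^ a) * (2 ^ |b| * ‖z‖ ^ b) :=
        mul_le_mul (rpow_le_of_half_le_of_le_two_mul a hz0 (by linarith) (by linarith))
          (rpow_le_of_half_le_of_le_two_mul b hz0 (by linarith) (by linarith))
          (by positivity) (by positivity)
    _ = _ := by ring

theorem tendsto_eval_mul_logWeight_cobounded (h : IsLogPair U la lb) {p : ℂ[X]} {N : ℕ} {a b : ℝ}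
    (hp : p.natDegree ≤ N) (hab : N + a + b < 0) :
    Tendsto (fun z => p.eval z * logWeight la lb a b z) (Bornology.cobounded ℂ ⊓ 𝓟 U) (𝓝 0) := by
  have h1 : (fun z => p.eval z) =O[Bornology.cobounded ℂ] fun z => (X ^ N : ℂ[X]).eval z :=
    isBigO_cobounded_of_degree_le (by
      rw [degree_X_pow]; exact natDegree_le_iff_degree_le.1 hp)
  obtain ⟨C, hC⟩ := h1.bound
  have ht : Tendsto (fun z : ℂ => C * (2 ^ |a| * 2 ^ |b|) * ‖z‖ ^ (-(-(N + a + b))))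
      (Bornology.cobounded ℂ ⊓ 𝓟 U) (𝓝 0) := by
    have := ((tendsto_rpow_neg_atTop (show 0 < -((N : ℝ) + a + b) by linarith)).comp
      (tendsto_norm_cobounded_atTop (E := ℂ))).const_mul (C * (2 ^ |a| * 2 ^ |b|))
    rw [mul_zero] at this
    exact this.mono_left inf_le_left
  refine squeeze_zero_norm' ?_ ht
  have h2 : ∀ᶠ z : ℂ in Bornology.cobounded ℂ, 2 ≤ ‖z‖ :=
    tendsto_norm_cobounded_atTop.eventually_ge_atTop 2
  filter_upwards [mem_inf_of_left hC, mem_inf_of_left h2, mem_inf_of_right (mem_principal_self U)]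
    with z hz1 hz2 hz
  have hz0 : 0 < ‖z‖ := by linarith [show 2 ≤ ‖z‖ from hz2]
  have hz1' : ‖p.eval z‖ ≤ C * ‖z‖ ^ N := by simpa using hz1
  rw [norm_mul, neg_neg, add_assoc, Real.rpow_add hz0, Real.rpow_natCast]
  calc _ ≤ (C * ‖z‖ ^ N) * (2 ^ |a| * 2 ^ |b| * ‖z‖ ^ (a + b)) :=
        mul_le_mul hz1' (h.norm_logWeight_le hz hz2 a b) (norm_nonneg _)
          ((norm_nonneg _).trans hz1')
    _ = _ := by ring

end IsLogPair

/-- The plane cut along `(-∞, -1]` and `[1, ∞)`. -/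
def doubleSlitPlane : Set ℂ := {z | 1 - z ∈ Complex.slitPlane ∧ z + 1 ∈ Complex.slitPlane}

theorem mem_doubleSlitPlane_iff {z : ℂ} :
    z ∈ doubleSlitPlane ↔ ¬(z.im = 0 ∧ (z.re ≤ -1 ∨ 1 ≤ z.re)) := by
  simp only [doubleSlitPlane, mem_ofPred_eq, Complex.mem_slitPlane_iff, Complex.sub_re,
    Complex.one_re, Complex.sub_im, Complex.one_im, Complex.add_re, Complex.add_im, add_zero,
    zero_sub, ne_eq, neg_eq_zero]
  by_cases h : z.im = 0
  · simp only [h, not_true_eq_false, or_false, true_and, not_or, not_le]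
    constructor <;> rintro ⟨h1, h2⟩ <;> constructor <;> linarith
  · simp [h]

theorem mem_doubleSlitPlane_of_im_ne_zero {z : ℂ} (hz : z.im ≠ 0) : z ∈ doubleSlitPlane :=
  mem_doubleSlitPlane_iff.2 fun h => hz h.1

theorem isOpen_doubleSlitPlane : IsOpen doubleSlitPlane :=
  (Complex.isOpen_slitPlane.preimage (by fun_prop : Continuous fun z : ℂ => 1 - z)).inter
    (Complex.isOpen_slitPlane.preimage (by fun_prop : Continuous fun z : ℂ => z + 1))

theorem starConvex_doubleSlitPlane : StarConvex ℝ 0 doubleSlitPlane := by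
  rw [starConvex_zero_iff]
  intro z hz t ht0 ht1
  rw [mem_doubleSlitPlane_iff] at hz ⊢
  rintro ⟨h1, h2⟩
  rw [Complex.real_smul, Complex.re_ofReal_mul] at h2
  rw [Complex.real_smul, Complex.im_ofReal_mul] at h1
  rcases mul_eq_zero.1 h1 with h | h
  · rw [h] at h2; norm_num at h2
  · refine hz ⟨h, ?_⟩
    have ht : 0 < t := ht0.lt_of_ne fun h => by rw [← h] at h2; norm_num at h2
    rcases h2 with h2 | h2
    · left
      by_contra! hx
      linarith [mul_pos ht (by linarith : 0 < z.re + 1)]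
    · right
      by_contra! hx
      linarith [mul_pos ht (by linarith : 0 < 1 - z.re)]

theorem isLogPair_doubleSlitPlane :
    IsLogPair doubleSlitPlane (fun z => Complex.log (1 - z)) (fun z => Complex.log (z + 1)) where
  isOpen := isOpen_doubleSlitPlane
  left_diff := fun z hz =>
      (DifferentiableAt.clog (f := fun z => 1 - z) (by fun_prop) hz.1).differentiableWithinAt
  right_diff := fun z hz =>
      (DifferentiableAt.clog (f := fun z => z + 1) (by fun_prop) hz.2).differentiableWithinAt
  left_exp := fun z hz => Complex.exp_log (Complex.slitPlane_ne_zero hz.1)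
  right_exp := fun z hz => Complex.exp_log (Complex.slitPlane_ne_zero hz.2)

/-- The principal branch of the weight on the doubly cut plane. -/
noncomputable abbrev stripWeight (a b : ℝ) : ℂ → ℂ :=
  logWeight (fun z => Complex.log (1 - z)) (fun z => Complex.log (z + 1)) a b

theorem halfInfty_le_cobounded_inf (σ : ℝ) :
    halfInfty σ ≤ Bornology.cobounded ℂ ⊓ 𝓟 doubleSlitPlane := by
  refine inf_le_inf_left _ (principal_mono.2 fun z hz => ?_)
  refine mem_doubleSlitPlane_of_im_ne_zero fun h => ?_
  simp [h] at hz

/-- Inversion turns the end at infinity into the convex set `D` with `0` on its boundary. The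
derivative of `F(1/w)` is of order `‖w‖^(-a-b-2)`, bounded because `a + b ≤ -2`. Hence `F(1/w)` is
Lipschitz on `D` and extends continuously to `0`. -/
theorem exists_tendsto_halfInfty {a b : ℝ} (hab : a + b ≤ -2) {F : ℂ → ℂ}
    (hF : ∀ z ∈ doubleSlitPlane, HasDerivAt F (stripWeight a b z) z) (σ : ℝ) :
    ∃ A, Tendsto F (halfInfty σ) (𝓝 A) := by
  set D : Set ℂ := {w | 0 < -(σ * w.im)} ∩ Metric.ball 0 (1 / 2) with hD
  have hDconv : Convex ℝ D := by
    refine Convex.inter (fun x hx y hy s t hs ht hst => ?_) (convex_ball _ _)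
    simp only [mem_ofPred_eq, Complex.add_im, Complex.real_smul, Complex.im_ofReal_mul] at *
    rcases hs.eq_or_lt with rfl | hs
    · rw [zero_add] at hst; subst hst; simpa using hy
    · nlinarith [mul_pos hs hx, mul_nonneg ht hy.le]
  have hD0 : ∀ w ∈ D, w ≠ 0 := fun w hw h => by simp [hD, h] at hw
  have hDU : ∀ w ∈ D, w⁻¹ ∈ doubleSlitPlane := fun w hw => by
    refine mem_doubleSlitPlane_of_im_ne_zero fun h => ?_
    rw [Complex.inv_im, div_eq_zero_iff] at h
    rcases h with h | h
    · have := hw.1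
      rw [neg_eq_zero] at h
      simp [h] at this
    · exact hD0 w hw (Complex.normSq_eq_zero.1 h)
  have hder : ∀ w ∈ D, HasDerivAt (fun w => F w⁻¹) (stripWeight a b w⁻¹ * -(w ^ 2)⁻¹) w :=
    fun w hw => (hF _ (hDU w hw)).comp w (hasDerivAt_inv (hD0 w hw))
  set C : ℝ := 2 ^ |a| * 2 ^ |b| with hC
  have hbound : ∀ w ∈ D, ‖deriv (fun w => F w⁻¹) w‖₊ ≤ C.toNNReal := by
    intro w hw
    have hw0 : 0 < ‖w‖ := norm_pos_iff.2 (hD0 w hw)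
    have hw1 : ‖w‖ < 1 / 2 := by simpa using hw.2
    have hinv : 2 ≤ ‖w⁻¹‖ := by
      rw [norm_inv, ← inv_inv (2 : ℝ)]
      exact inv_anti₀ hw0 (by linarith)
    rw [(hder w hw).deriv, ← NNReal.coe_le_coe, Real.coe_toNNReal _ (by positivity), coe_nnnorm,
      norm_mul, norm_neg, norm_inv, norm_pow]
    have h1 := isLogPair_doubleSlitPlane.norm_logWeight_le (hDU w hw) hinv a b
    calc _ ≤ C * ‖w⁻¹‖ ^ (a + b) * (‖w‖ ^ 2)⁻¹ := by gcongr
      _ = C * ‖w⁻¹‖ ^ (a + b + 2) := by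
        rw [Real.rpow_add (by linarith) (a + b) 2, mul_assoc, norm_inv, ← inv_pow, Real.rpow_two]
      _ ≤ C * 1 := by
        gcongr
        exact Real.rpow_le_one_of_one_le_of_nonpos (by linarith) (by linarith)
      _ = C := mul_one C
  have hlip := hDconv.lipschitzOnWith_of_nnnorm_deriv_le
    (fun w hw => (hder w hw).differentiableAt) hbound
  obtain ⟨g, hg, hgeq⟩ := hlip.extend_finite_dimension
  refine ⟨g 0, ?_⟩
  have ht : Tendsto (fun z : ℂ => g z⁻¹) (halfInfty σ) (𝓝 (g 0)) :=
    (hg.continuous.tendsto 0).comp ((tendsto_inv₀_cobounded (α := ℂ)).mono_left inf_le_left)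
  refine ht.congr' ?_
  have h2 : ∀ᶠ z : ℂ in Bornology.cobounded ℂ, 2 < ‖z‖ :=
    tendsto_norm_cobounded_atTop.eventually_gt_atTop 2
  filter_upwards [mem_inf_of_left h2, mem_inf_of_right (mem_principal_self _)] with z hz2 hz
  have hz0 : z ≠ 0 := fun h => by simp [h] at hz
  have hzD : z⁻¹ ∈ D := by
    refine ⟨?_, ?_⟩
    · rw [mem_ofPred_eq, Complex.inv_im, mul_div_assoc', ← neg_div]
      exact div_pos (by simpa using hz) (Complex.normSq_pos.2 hz0)
    · rw [mem_ball_zero_iff, norm_inv, one_div]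
      exact inv_strictAnti₀ two_pos hz2
  rw [← hgeq hzD]
  simp

/-! ### Jumps of primitives, and nonvanishing for the doubly cut plane. -/

/-- `f` has a primitive on `U` with limits along `l₁` and `l₂`, which differ by `L`. -/
def HasEndJump (U : Set ℂ) (l₁ l₂ : Filter ℂ) (f : ℂ → ℂ) (L : ℂ) : Prop :=
  ∃ (F : ℂ → ℂ) (A B : ℂ), (∀ z ∈ U, HasDerivAt F (f z) z) ∧ Tendsto F l₁ (𝓝 A) ∧
    Tendsto F l₂ (𝓝 B) ∧ B - A = L

/-- A derivative of a function vanishing at both ends contributes nothing to the jump. All exponent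
shifts below are instances. -/
theorem HasEndJump.of_eq_add {U : Set ℂ} {l₁ l₂ : Filter ℂ} {f g k G : ℂ → ℂ} {L c d : ℂ}
    (h : HasEndJump U l₁ l₂ f L) (hG : ∀ z ∈ U, HasDerivAt G (g z) z) (h₁ : Tendsto G l₁ (𝓝 0))
    (h₂ : Tendsto G l₂ (𝓝 0)) (hk : ∀ z ∈ U, k z = c * f z + d * g z) :
    HasEndJump U l₁ l₂ k (c * L) := by
  obtain ⟨F, A, B, hF, hA, hB, rfl⟩ := h
  refine ⟨fun z => c * F z + d * G z, c * A, c * B, fun z hz => ?_, ?_, ?_, by ring⟩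
  · rw [hk z hz]
    exact ((hF z hz).const_mul c).add ((hG z hz).const_mul d)
  · simpa using (hA.const_mul c).add (h₁.const_mul d)
  · simpa using (hB.const_mul c).add (h₂.const_mul d)

theorem HasEndJump.hasContourIntegral {U : Set ℂ} {l₁ l₂ : Filter ℂ} {f g : ℂ → ℂ} {L c : ℂ}
    {γ : ℝ → ℂ} (h : HasEndJump U l₁ l₂ f L) (hU : IsOpen U) (hγ : IsLocallyAC γ)
    (hmem : ∀ s ∈ Ioo (0 : ℝ) 1, γ s ∈ U) (h₁ : Tendsto γ (𝓝[>] 0) l₁)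
    (h₂ : Tendsto γ (𝓝[<] 1) l₂) (hg : ∀ z ∈ γ '' Ioo 0 1, c * f z = g z) :
    HasContourIntegral γ g (c * L) := by
  obtain ⟨F, A, B, hF, hA, hB, rfl⟩ := h
  rw [mul_sub]
  exact (hγ.hasContourIntegral hU hmem (fun z hz => (hF z hz).const_mul c) h₁ h₂
    (hA.const_mul c) (hB.const_mul c)).congr hg

theorem tendsto_stripWeight_halfInfty {a b : ℝ} (hab : a + b < 0) (σ : ℝ) :
    Tendsto (stripWeight a b) (halfInfty σ) (𝓝 0) := by
  have := isLogPair_doubleSlitPlane.tendsto_eval_mul_logWeight_cobounded (p := 1) (N := 0)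
    (a := a) (b := b) (by simp) (by simpa using hab)
  simpa using this.mono_left (halfInfty_le_cobounded_inf σ)

/-- The jump of the primitive of the weight between the two half-plane infinities. -/
abbrev HasStripJump (a b : ℝ) (L : ℂ) : Prop :=
  HasEndJump doubleSlitPlane (halfInfty 1) (halfInfty (-1)) (stripWeight a b) L

theorem exists_primitive_stripWeight (a b : ℝ) :
    ∃ F : ℂ → ℂ, ∀ z ∈ doubleSlitPlane, HasDerivAt F (stripWeight a b z) z :=
  exists_primitive_of_starConvex isOpen_doubleSlitPlane starConvex_doubleSlitPlane
    (isLogPair_doubleSlitPlane.differentiableOn_logWeight a b)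

/-- Lowering `b` by one brings the exponent sum below `-2`, where limits exist. The derivative of
`w(a+1,b)` leads back to `(a,b)`, and `w(a+1,b)` vanishes at infinity because `a + b + 1 < 0`. -/
theorem exists_hasStripJump {a b : ℝ} (hab : a + b < -1) : ∃ L, HasStripJump a b L := by
  obtain ⟨F, hF⟩ := exists_primitive_stripWeight a (b - 1)
  obtain ⟨A, hA⟩ := exists_tendsto_halfInfty (by linarith) hF 1
  obtain ⟨B, hB⟩ := exists_tendsto_halfInfty (by linarith) hF (-1)
  have h : HasStripJump a (b - 1) (B - A) := ⟨F, A, B, hF, hA, hB, rfl⟩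
  have hne : (a : ℂ) + b + 1 ≠ 0 := by
    have : a + b + 1 ≠ 0 := by linarith
    exact_mod_cast this
  refine ⟨_, h.of_eq_add (c := 2 * b / (a + b + 1)) (d := -1 / (a + b + 1))
    (fun z hz => isLogPair_doubleSlitPlane.hasDerivAt_logWeight_add_one_left hz a b)
    (tendsto_stripWeight_halfInfty (by linarith) 1)
    (tendsto_stripWeight_halfInfty (by linarith) (-1)) fun z hz => ?_⟩
  field_simp
  ring

theorem HasStripJump.shift_left {a b : ℝ} {L : ℂ} (h : HasStripJump a b L) (hab : a + b < -1)
    (hb : b ≠ 0) : HasStripJump (a + 1) (b - 1) ((a + 1) / b * L) := by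
  have hb' : (b : ℂ) ≠ 0 := by exact_mod_cast hb
  refine h.of_eq_add (d := 1 / b)
    (fun z hz => isLogPair_doubleSlitPlane.hasDerivAt_logWeight_add_one_left' hz a b)
    (tendsto_stripWeight_halfInfty (by linarith) 1)
    (tendsto_stripWeight_halfInfty (by linarith) (-1)) fun z hz => ?_
  field_simp
  ring

theorem HasStripJump.shift_right {a b : ℝ} {L : ℂ} (h : HasStripJump (a + 1) (b - 1) L)
    (hab : a + b < -1) (ha : a + 1 ≠ 0) : HasStripJump a b (b / (a + 1) * L) := by
  have ha' : (a : ℂ) + 1 ≠ 0 := by exact_mod_cast ha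
  refine h.of_eq_add (d := -1 / (a + 1))
    (fun z hz => isLogPair_doubleSlitPlane.hasDerivAt_logWeight_add_one_left' hz a b)
    (tendsto_stripWeight_halfInfty (by linarith) 1)
    (tendsto_stripWeight_halfInfty (by linarith) (-1)) fun z hz => ?_
  field_simp
  ring

/-- The points `1 - iy` and `1 + iy` are conjugate, so the weight has argument `(b - a) arg(1 +
iy)`, of modulus below `π/2`. -/
theorem re_stripWeight_mul_I_pos {a b : ℝ} (hab : |b - a| ≤ 1) (y : ℝ) :
    0 < (stripWeight a b (y * Complex.I)).re := by
  have hre : 0 < ((y : ℂ) * Complex.I + 1).re := by simp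
  have harg := Complex.abs_arg_lt_pi_div_two_iff.2 (Or.inl hre)
  have hconj : (1 : ℂ) - y * Complex.I = (starRingEnd ℂ) (y * Complex.I + 1) := by
    apply Complex.ext <;> simp
  have hne : Complex.arg ((y : ℂ) * Complex.I + 1) ≠ Real.pi := fun h => by
    rw [h, abs_of_pos Real.pi_pos] at harg
    linarith [Real.pi_pos]
  rw [stripWeight, logWeight, hconj, Complex.log_conj _ hne, Complex.exp_re]
  refine mul_pos (Real.exp_pos _) ?_
  simp only [Complex.add_im, Complex.im_ofReal_mul, Complex.conj_im, Complex.log_im]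
  have e : a * -Complex.arg ((y : ℂ) * Complex.I + 1) + b * Complex.arg ((y : ℂ) * Complex.I + 1) =
    (b - a) * Complex.arg ((y : ℂ) * Complex.I + 1) := by ring
  rw [e]
  refine Real.cos_pos_of_mem_Ioo (abs_lt.1 ?_)
  rw [abs_mul]
  nlinarith [abs_nonneg (Complex.arg ((y : ℂ) * Complex.I + 1))]

theorem tendsto_mul_I_halfInfty {σ : ℝ} {l : Filter ℝ} (h : Tendsto (fun y => σ * y) l atTop)
    (hσ : |σ| = 1) : Tendsto (fun y : ℝ => (y : ℂ) * Complex.I) l (halfInfty σ) := by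
  refine tendsto_inf.2 ⟨?_, tendsto_principal.2 ?_⟩
  · rw [← tendsto_norm_atTop_iff_cobounded]
    refine tendsto_atTop_mono (fun y => ?_) h
    rw [norm_mul, Complex.norm_I, mul_one, Complex.norm_real, Real.norm_eq_abs]
    calc σ * y ≤ |σ * y| := le_abs_self _
      _ = |y| := by rw [abs_mul, hσ, one_mul]
  · filter_upwards [h.eventually_gt_atTop 0] with y hy
    simpa using hy

/-- Along `iy` the primitive has derivative `i w(iy)`, so its imaginary part increases strictly and
its limits at the two ends differ. -/
theorem HasStripJump.ne_zero {a b : ℝ} {L : ℂ} (h : HasStripJump a b L) (hab : |b - a| ≤ 1) :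
    L ≠ 0 := by
  obtain ⟨F, A, B, hF, hA, hB, rfl⟩ := h
  have hd : ∀ y : ℝ, HasDerivAt (fun y : ℝ => (F (y * Complex.I)).im)
      (stripWeight a b (y * Complex.I)).re y := by
    intro y
    have hmem : (y : ℂ) * Complex.I ∈ doubleSlitPlane :=
      mem_doubleSlitPlane_iff.2 (by simp)
    have h0 : HasDerivAt (fun y : ℝ => (y : ℂ) * Complex.I) (1 * Complex.I) y :=
      ((hasDerivAt_id y).ofReal_comp).mul_const _
    have h1 := (hF _ hmem).comp y h0
    have h2 := Complex.imCLM.hasFDerivAt.comp_hasDerivAt y h1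
    refine h2.congr_deriv ?_
    simp
  have hmono : StrictMono (fun y : ℝ => (F (y * Complex.I)).im) :=
    strictMono_of_deriv_pos fun y => by
      rw [(hd y).deriv]
      exact re_stripWeight_mul_I_pos hab y
  have hA' : Tendsto (fun y : ℝ => (F (y * Complex.I)).im) atTop (𝓝 A.im) :=
    (Complex.continuous_im.tendsto A).comp
      (hA.comp (tendsto_mul_I_halfInfty (by simp only [one_mul]; exact tendsto_id) (by simp)))
  have hB' : Tendsto (fun y : ℝ => (F (y * Complex.I)).im) atBot (𝓝 B.im) :=
    (Complex.continuous_im.tendsto B).comp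
      (hB.comp (tendsto_mul_I_halfInfty (by simpa using tendsto_neg_atBot_atTop) (by simp)))
  have h1 := hmono.monotone.ge_of_tendsto hA' 1
  have h2 := hmono.monotone.le_of_tendsto hB' 0
  have h3 := hmono (show (0 : ℝ) < 1 by norm_num)
  intro h
  rw [sub_eq_zero.1 h] at h2
  exact absurd (h2.trans_lt h3) (not_lt.2 h1)

/-- Shifts preserve `a + b` and change `b - a` by two, so rounding `(b - a)/2` yields a pair with
difference at most one. The way back multiplies the jump by quotients of non-integers, which are
nonzero. -/
theorem exists_hasStripJump_ne_zero {a b : ℝ} (hab : a + b < -1) (ha : ∀ j : ℤ, a ≠ j)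
    (hb : ∀ j : ℤ, b ≠ j) : ∃ L, L ≠ 0 ∧ HasStripJump a b L := by
  obtain ⟨m, hm⟩ : ∃ m : ℤ, |(b - m) - (a + m)| ≤ 1 := by
    refine ⟨round ((b - a) / 2), ?_⟩
    have := abs_sub_round ((b - a) / 2)
    rw [abs_le] at this ⊢
    constructor <;> linarith
  obtain ⟨L, hL⟩ := exists_hasStripJump (a := a + m) (b := b - m) (by linarith)
  have h0 : ∃ L, L ≠ 0 ∧ HasStripJump (a + m) (b - m) L := ⟨L, hL.ne_zero hm, hL⟩
  suffices h : ∀ i : ℤ, ∃ L, L ≠ 0 ∧ HasStripJump (a + m + i) (b - m - i) L by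
    obtain ⟨L, hL, h⟩ := h (-m)
    refine ⟨L, hL, ?_⟩
    push_cast at h
    rwa [add_neg_cancel_right, sub_neg_eq_add, sub_add_cancel] at h
  have ha' : ∀ i : ℤ, a + m + i + 1 ≠ 0 := fun i h => ha (-(m + i + 1)) (by push_cast; linarith)
  have hb' : ∀ i : ℤ, b - m - i ≠ 0 := fun i h => hb (m + i) (by push_cast; linarith)
  intro i
  induction i with
  | zero => simpa using h0
  | succ i ih =>
    obtain ⟨L, hL, h⟩ := ih
    have hs := h.shift_left (by linarith) (hb' i)
    have e1 : a + m + (((i : ℤ) + 1 : ℤ) : ℝ) = a + m + ((i : ℤ) : ℝ) + 1 := by push_cast; ring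
    have e2 : b - m - (((i : ℤ) + 1 : ℤ) : ℝ) = b - m - ((i : ℤ) : ℝ) - 1 := by push_cast; ring
    rw [e1, e2]
    refine ⟨_, mul_ne_zero (div_ne_zero ?_ ?_) hL, hs⟩
    · exact_mod_cast ha' i
    · exact_mod_cast hb' i
  | pred i ih =>
    obtain ⟨L, hL, h⟩ := ih
    have e1 : a + m + ((-(i : ℤ) : ℤ) : ℝ) = a + m + ((-(i : ℤ) - 1 : ℤ) : ℝ) + 1 := by
      push_cast; ring
    have e2 : b - m - ((-(i : ℤ) : ℤ) : ℝ) = b - m - ((-(i : ℤ) - 1 : ℤ) : ℝ) - 1 := by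
      push_cast; ring
    rw [e1, e2] at h
    have hs := HasStripJump.shift_right h (by linarith) (ha' _)
    refine ⟨_, mul_ne_zero (div_ne_zero ?_ ?_) hL, hs⟩
    · exact_mod_cast hb' (-(i : ℤ) - 1)
    · exact_mod_cast ha' (-(i : ℤ) - 1)

/-! ### The plane cut along `(-∞, 1]` and its Möbius transport. -/

/-- The plane cut along `(-∞, 1]`. -/
def raySlitPlane : Set ℂ := {z | z - 1 ∈ Complex.slitPlane}

theorem mem_raySlitPlane_iff {z : ℂ} : z ∈ raySlitPlane ↔ ¬(z.im = 0 ∧ z.re ≤ 1) := by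
  simp only [raySlitPlane, mem_ofPred_eq, Complex.mem_slitPlane_iff, Complex.sub_re,
    Complex.one_re, Complex.sub_im, Complex.one_im, sub_zero, not_and_or, not_le, sub_pos]
  tauto

theorem isOpen_raySlitPlane : IsOpen raySlitPlane :=
  Complex.isOpen_slitPlane.preimage (by fun_prop : Continuous fun z : ℂ => z - 1)

theorem add_one_mem_slitPlane_of_mem_raySlitPlane {z : ℂ} (hz : z ∈ raySlitPlane) :
    z + 1 ∈ Complex.slitPlane := by
  rw [raySlitPlane, mem_ofPred_eq, Complex.mem_slitPlane_iff] at hz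
  rw [Complex.mem_slitPlane_iff]
  simp only [Complex.sub_re, Complex.sub_im, Complex.add_re, Complex.add_im, Complex.one_re,
    Complex.one_im, sub_zero, add_zero] at hz ⊢
  exact hz.imp (fun h => by linarith) id

/-- The Möbius map taking `-1, 1, ∞` to `∞, -1, 1`. -/
noncomputable def cycleMap (z : ℂ) : ℂ := 1 - 4 / (z + 1)

theorem one_sub_cycleMap (z : ℂ) : 1 - cycleMap z = 4 / (z + 1) := by
  rw [cycleMap, sub_sub_cancel]

theorem cycleMap_add_one {z : ℂ} (hz : z + 1 ≠ 0) :
    cycleMap z + 1 = 2 * (z - 1) / (z + 1) := by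
  rw [cycleMap]
  field_simp
  ring

theorem cycleMap_im (z : ℂ) : (cycleMap z).im = 4 * z.im / Complex.normSq (z + 1) := by
  rw [cycleMap, div_eq_mul_inv, Complex.sub_im, Complex.mul_im, Complex.inv_im, Complex.inv_re]
  simp
  ring

theorem cycleMap_mem {z : ℂ} (hz : z ∈ raySlitPlane) : cycleMap z ∈ doubleSlitPlane := by
  have h1 := Complex.slitPlane_ne_zero (add_one_mem_slitPlane_of_mem_raySlitPlane hz)
  by_cases him : z.im = 0
  · have hre : 1 < z.re := by
      by_contra! h
      exact mem_raySlitPlane_iff.1 hz ⟨him, h⟩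
    have e : z = (z.re : ℂ) := Complex.ext (by simp) (by simpa using him)
    refine ⟨?_, ?_⟩
    · rw [one_sub_cycleMap, e]
      have : (4 : ℂ) / ((z.re : ℂ) + 1) = ((4 / (z.re + 1) : ℝ) : ℂ) := by push_cast; rfl
      rw [this, Complex.ofReal_mem_slitPlane]
      exact div_pos (by norm_num) (by linarith)
    · rw [cycleMap_add_one h1, e]
      have : 2 * ((z.re : ℂ) - 1) / ((z.re : ℂ) + 1) =
          ((2 * (z.re - 1) / (z.re + 1) : ℝ) : ℂ) := by push_cast; rfl
      rw [this, Complex.ofReal_mem_slitPlane]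
      exact div_pos (by linarith) (by linarith)
  · refine mem_doubleSlitPlane_of_im_ne_zero ?_
    rw [cycleMap_im]
    exact div_ne_zero (mul_ne_zero (by norm_num) him) (fun h => h1 (Complex.normSq_eq_zero.1 h))

/-- Written in terms of the image point, the Jacobian is a power of `1 - cycleMap z` and merely
shifts an exponent of the weight by two. -/
theorem hasDerivAt_cycleMap {z : ℂ} (hz : z + 1 ≠ 0) :
    HasDerivAt cycleMap ((1 - cycleMap z) ^ 2 / 4) z := by
  have h := (((hasDerivAt_id z).add_const 1).inv hz).const_mul 4 |>.const_sub 1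
  refine h.congr_deriv ?_
  rw [one_sub_cycleMap]
  simp only [id]
  field_simp

theorem tendsto_cycleMap (σ : ℝ) :
    Tendsto cycleMap (𝓝[{z | 0 < σ * z.im}] (-1)) (halfInfty σ) := by
  have hne : ∀ z : ℂ, 0 < σ * z.im → z + 1 ≠ 0 := fun z hz h => by
    rw [eq_neg_of_add_eq_zero_left h] at hz
    simp at hz
  refine tendsto_inf.2 ⟨?_, tendsto_principal.2 ?_⟩
  · have h1 : Tendsto (fun z : ℂ => z + 1) (𝓝[{z | 0 < σ * z.im}] (-1)) (𝓝[≠] 0) := by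
      refine tendsto_nhdsWithin_iff.2 ⟨?_, ?_⟩
      · have : Tendsto (fun z : ℂ => z + 1) (𝓝 (-1)) (𝓝 (-1 + 1)) :=
          (continuous_id.add continuous_const).tendsto _
        rw [neg_add_cancel] at this
        exact this.mono_left nhdsWithin_le_nhds
      · filter_upwards [self_mem_nhdsWithin] with z hz using hne z hz
    have h2 := tendsto_norm_cobounded_atTop.comp ((tendsto_inv₀_nhdsNE_zero (α := ℂ)).comp h1)
    rw [← tendsto_norm_atTop_iff_cobounded]
    have h3 := tendsto_atTop_add_const_right _ (-1 : ℝ)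
        (h2.const_mul_atTop (show (0 : ℝ) < 4 by norm_num))
    refine tendsto_atTop_mono (fun z => ?_) h3
    have h4 := norm_sub_norm_le (4 / (z + 1)) 1
    rw [norm_sub_rev, div_eq_mul_inv, norm_mul, norm_one] at h4
    simpa [cycleMap, div_eq_mul_inv, sub_eq_add_neg] using h4
  · filter_upwards [self_mem_nhdsWithin] with z hz
    rw [cycleMap_im, ← mul_div_assoc, mul_left_comm]
    exact div_pos (mul_pos (by norm_num) hz) (Complex.normSq_pos.2 (hne z hz))

/-- A branch of `log (1 - z)` on the plane cut along `(-∞, 1]`. -/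
noncomputable def rayLogLeft (z : ℂ) : ℂ :=
  -- With `ζ = cycleMap z` one has `1 - z = -2 (ζ + 1)/(1 - ζ)`; the added constant is a logarithm
  -- of `-2`.
  Complex.log (cycleMap z + 1) - Complex.log (1 - cycleMap z) +
      (Complex.log 2 + Real.pi * Complex.I)

/-- A branch of `log (z + 1)` on the plane cut along `(-∞, 1]`. -/
noncomputable def rayLogRight (z : ℂ) : ℂ := Complex.log 4 - Complex.log (1 - cycleMap z)

theorem isLogPair_raySlitPlane : IsLogPair raySlitPlane rayLogLeft rayLogRight where
  isOpen := isOpen_raySlitPlane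
  left_diff := fun z hz => by
    have h1 := Complex.slitPlane_ne_zero (add_one_mem_slitPlane_of_mem_raySlitPlane hz)
    have h2 := (hasDerivAt_cycleMap h1).differentiableAt
    exact ((((h2.add_const 1).clog (cycleMap_mem hz).2).sub
      ((h2.const_sub 1).clog (cycleMap_mem hz).1)).add_const _).differentiableWithinAt
  right_diff := fun z hz => by
    have h1 := Complex.slitPlane_ne_zero (add_one_mem_slitPlane_of_mem_raySlitPlane hz)
    have h2 := (hasDerivAt_cycleMap h1).differentiableAt
    exact (((h2.const_sub 1).clog (cycleMap_mem hz).1).const_sub _).differentiableWithinAt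
  left_exp := fun z hz => by
    have h1 := Complex.slitPlane_ne_zero (add_one_mem_slitPlane_of_mem_raySlitPlane hz)
    rw [rayLogLeft, Complex.exp_add, Complex.exp_sub, Complex.exp_add, Complex.exp_pi_mul_I,
      Complex.exp_log two_ne_zero, Complex.exp_log (Complex.slitPlane_ne_zero (cycleMap_mem hz).1),
      Complex.exp_log (Complex.slitPlane_ne_zero (cycleMap_mem hz).2), one_sub_cycleMap,
      cycleMap_add_one h1]
    field_simp
    ring
  right_exp := fun z hz => by
    have h1 := Complex.slitPlane_ne_zero (add_one_mem_slitPlane_of_mem_raySlitPlane hz)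
    rw [rayLogRight, Complex.exp_sub, Complex.exp_log (by norm_num : (4 : ℂ) ≠ 0),
      Complex.exp_log (Complex.slitPlane_ne_zero (cycleMap_mem hz).1), one_sub_cycleMap]
    field_simp

/-- Substituting `ζ = cycleMap z` turns `w(z;a,b) dz` into a constant times `w(ζ;-a-b-2,a) dζ`. The
new exponent sum is `-b-2`, below `-1` exactly when `b > -1`, and neither new exponent is an
integer. -/
theorem exists_hasEndJump_raySlitPlane {a b : ℝ} (hb : -1 < b) (ha : ∀ j : ℤ, a ≠ j)
    (hab : ∀ j : ℤ, a + b ≠ j) :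
    ∃ L, L ≠ 0 ∧ HasEndJump raySlitPlane (𝓝[{z | 0 < z.im}] (-1)) (𝓝[{z | z.im < 0}] (-1))
      (logWeight rayLogLeft rayLogRight a b) L := by
  obtain ⟨L, hL, F, A, B, hF, hA, hB, rfl⟩ := exists_hasStripJump_ne_zero (a := -a - b - 2) (b := a)
    (by linarith) (fun j h => hab (-j - 2) (by push_cast; linarith)) ha
  set K : ℂ := Complex.exp (a * (Complex.log 2 + Real.pi * Complex.I) + b * Complex.log 4) with hK
  refine ⟨4 * K * (B - A), mul_ne_zero (mul_ne_zero (by norm_num : (4 : ℂ) ≠ 0)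
      (Complex.exp_ne_zero _)) hL,
    fun z => 4 * K * F (cycleMap z), 4 * K * A, 4 * K * B, fun z hz => ?_, ?_, ?_, by ring⟩
  · have h1 := Complex.slitPlane_ne_zero (add_one_mem_slitPlane_of_mem_raySlitPlane hz)
    have h2 := ((hF _ (cycleMap_mem hz)).comp z (hasDerivAt_cycleMap h1)).const_mul (4 * K)
    refine h2.congr_deriv ?_
    have h3 : (1 - cycleMap z) ^ 2 = Complex.exp (2 * Complex.log (1 - cycleMap z)) := by
      rw [two_mul, Complex.exp_add, ← pow_two,
          Complex.exp_log (Complex.slitPlane_ne_zero (cycleMap_mem hz).1)]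
    have h4 : K * stripWeight (-a - b - 2) a (cycleMap z) * (1 - cycleMap z) ^ 2 =
        logWeight rayLogLeft rayLogRight a b z := by
      rw [h3, hK, stripWeight, logWeight, logWeight, ← Complex.exp_add, ← Complex.exp_add,
        rayLogLeft, rayLogRight]
      congr 1
      push_cast
      ring
    rw [← h4]
    ring
  · have := tendsto_cycleMap 1
    simp only [one_mul] at this
    exact (hA.comp this).const_mul _
  · have := tendsto_cycleMap (-1)
    simp only [neg_one_mul, neg_pos] at this
    exact (hB.comp this).const_mul _

/-! ### Boundary terms of the integration by parts. -/

/-- The terms produced by repeated integration by parts of `q P_n^{(α,β)} w(α,β)` vanish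
along `l`. -/
def BoundaryTermsVanish (la lb : ℂ → ℂ) (n : ℕ) (α β : ℝ) (q : ℂ[X]) (l : Filter ℂ) : Prop :=
  ∀ i j : ℕ, i + j + 1 = n → Tendsto (fun z => (derivative^[j] q).eval z *
    (jacobiPolynomial i ((α + j + 1 : ℝ) : ℂ) ((β + j + 1 : ℝ) : ℂ)).eval z *
    logWeight la lb (α + j + 1) (β + j + 1) z) l (𝓝 0)

namespace IsLogPair

variable {U : Set ℂ} {la lb : ℂ → ℂ} {l₁ l₂ : Filter ℂ} {n : ℕ} {α β : ℝ} {q : ℂ[X]}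

theorem hasEndJump_mul_jacobiPolynomial (h : IsLogPair U la lb) {L : ℂ}
    (hL : HasEndJump U l₁ l₂ (logWeight la lb (α + n) (β + n)) L) (hq : q.natDegree ≤ n)
    (h₁ : BoundaryTermsVanish la lb n α β q l₁) (h₂ : BoundaryTermsVanish la lb n α β q l₂) :
    HasEndJump U l₁ l₂ (fun z => q.eval z * (jacobiPolynomial n α β).eval z * logWeight la lb α β z)
      (q.coeff n / 2 ^ n * L) := by
  obtain ⟨F, A, B, hF, hA, hB, rfl⟩ := hL
  obtain ⟨Φ, hΦ, hl⟩ := h.exists_primitive_mul_jacobiPolynomial n α β F q hF hq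
  refine ⟨Φ, q.coeff n / 2 ^ n * A, q.coeff n / 2 ^ n * B, hΦ, ?_, ?_, by ring⟩
  · simpa using (hl l₁ h₁).add (hA.const_mul (q.coeff n / 2 ^ n))
  · simpa using (hl l₂ h₂).add (hB.const_mul (q.coeff n / 2 ^ n))

/-- When the coefficient of `F` is zero, `F` needs no limits at the ends. This matters in (iii),
where the integral of `w(α+n,β+n)` may diverge. -/
theorem hasEndJump_mul_jacobiPolynomial_zero (h : IsLogPair U la lb) {F : ℂ → ℂ}
    (hF : ∀ z ∈ U, HasDerivAt F (logWeight la lb (α + n) (β + n) z) z) (hq : q.natDegree < n)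
    (h₁ : BoundaryTermsVanish la lb n α β q l₁) (h₂ : BoundaryTermsVanish la lb n α β q l₂) :
    HasEndJump U l₁ l₂ (fun z => q.eval z * (jacobiPolynomial n α β).eval z * logWeight la lb α β z)
      0 := by
  obtain ⟨Φ, hΦ, hl⟩ := h.exists_primitive_mul_jacobiPolynomial n α β F q hF hq.le
  simp only [coeff_eq_zero_of_natDegree_lt hq, zero_div, zero_mul, sub_zero] at hl
  exact ⟨Φ, 0, 0, hΦ, hl l₁ h₁, hl l₂ h₂, sub_zero 0⟩

/-- The `(i,j)` term has growth exponent at most `(deg q - j) + i + α + β + 2j + 2`, which equals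
`deg q + n + 1 + α + β` for every `j`. -/
theorem boundaryTermsVanish_cobounded (h : IsLogPair U la lb)
    (hq : q.natDegree + n + 1 + α + β < 0) :
    BoundaryTermsVanish la lb n α β q (Bornology.cobounded ℂ ⊓ 𝓟 U) := by
  intro i j hij
  rcases lt_or_ge q.natDegree j with hj | hj
  · simpa [iterate_derivative_eq_zero hj] using tendsto_const_nhds
  simp only [← eval_mul]
  refine h.tendsto_eval_mul_logWeight_cobounded (N := (q.natDegree - j) + i)
    (natDegree_mul_le.trans (add_le_add (natDegree_iterate_derivative _ _)
      (natDegree_jacobiPolynomial_le _ _ _))) ?_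
  push_cast [hj]
  rw [← hij] at hq
  push_cast at hq
  linarith

theorem tendsto_logWeight_neg_one (h : IsLogPair U la lb) (α : ℝ) (hβ : 0 < β) :
    Tendsto (logWeight la lb α β) (𝓝 (-1) ⊓ 𝓟 U) (𝓝 0) := by
  rw [tendsto_zero_iff_norm_tendsto_zero]
  have h1 : Tendsto (fun z : ℂ => ‖1 - z‖ ^ α * ‖z + 1‖ ^ β) (𝓝 (-1) ⊓ 𝓟 U) (𝓝 0) := by
    have c1 : Tendsto (fun z : ℂ => ‖1 - z‖) (𝓝 (-1)) (𝓝 ‖(1 : ℂ) - -1‖) :=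
      (by fun_prop : Continuous fun z : ℂ => ‖1 - z‖).tendsto _
    have c2 : Tendsto (fun z : ℂ => ‖z + 1‖) (𝓝 (-1)) (𝓝 ‖(-1 : ℂ) + 1‖) :=
      (by fun_prop : Continuous fun z : ℂ => ‖z + 1‖).tendsto _
    have := (c1.rpow_const (p := α) (Or.inl (by norm_num))).mul
      (c2.rpow_const (p := β) (Or.inr hβ.le))
    rw [neg_add_cancel, norm_zero, Real.zero_rpow hβ.ne', mul_zero] at this
    exact this.mono_left inf_le_left
  refine h1.congr' ?_
  filter_upwards [mem_inf_of_right (mem_principal_self U)] with z hz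
  exact (h.norm_logWeight hz α β).symm

/-- The `j`-th derivative keeps a factor `(X+1)^(k-j)`, and `w(α+j+1,β+j+1)` supplies `β+j+1` more.
The total exponent is at least `β + k + 1 > 0`, also when `j > k` and the subtraction truncates. -/
theorem boundaryTermsVanish_neg_one (h : IsLogPair U la lb) {k : ℕ} (hk : -1 < β + k)
    (hq : (X + 1) ^ k ∣ q) : BoundaryTermsVanish la lb n α β q (𝓝 (-1) ⊓ 𝓟 U) := by
  intro i j _
  obtain ⟨S, hS⟩ := pow_sub_dvd_iterate_derivative_of_pow_dvd j hq
  set P := jacobiPolynomial i ((α + j + 1 : ℝ) : ℂ) ((β + j + 1 : ℝ) : ℂ)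
  have hpos : 0 < β + j + 1 + (k - j : ℕ) := by
    have : (k : ℝ) ≤ j + (k - j : ℕ) := by exact_mod_cast le_add_tsub
    linarith
  have h1 := h.tendsto_logWeight_neg_one (α + j + 1) hpos
  have h2 : Tendsto (fun z => (S * P).eval z) (𝓝 (-1) ⊓ 𝓟 U) (𝓝 ((S * P).eval (-1))) :=
    ((S * P).continuous.tendsto (-1)).mono_left inf_le_left
  have h3 := h2.mul h1
  rw [mul_zero] at h3
  refine h3.congr' ?_
  filter_upwards [mem_inf_of_right (mem_principal_self U)] with z hz
  rw [h.logWeight_add_natCast_right hz, hS]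
  simp only [eval_mul, eval_pow, eval_add, eval_X, eval_one]
  ring

end IsLogPair

theorem BoundaryTermsVanish.mono {la lb : ℂ → ℂ} {n : ℕ} {α β : ℝ} {q : ℂ[X]} {l l' : Filter ℂ}
    (h : BoundaryTermsVanish la lb n α β q l) (hl : l' ≤ l) :
    BoundaryTermsVanish la lb n α β q l' := fun i j hij => (h i j hij).mono_left hl

theorem nhdsWithin_neg_one_le {s : Set ℂ} (hs : ∀ z ∈ s, z.im ≠ 0) :
    𝓝[s] (-1) ≤ 𝓝 (-1) ⊓ 𝓟 raySlitPlane :=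
  inf_le_inf_left _ (principal_mono.2 fun z hz => mem_raySlitPlane_iff.2 fun h => hs z hz h.1)

theorem add_nat_ne_int {x : ℝ} (hx : ∀ j : ℤ, x ≠ j) (n : ℕ) (j : ℤ) : x + n ≠ j := fun h =>
  hx (j - n) (by push_cast; linarith)

/-! ### The three families of curves. -/

theorem orthogonality_gammaNegOne (n : ℕ) (α β : ℝ) (hα : ∀ j : ℤ, α ≠ j)
    (hαβ : ∀ j : ℤ, α + β ≠ j) (hn : -1 < n + β) (k : ℤ) (hk : k = max 0 ⌊-β⌋) (γ : ℝ → ℂ)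
    (hγ : IsGammaNegOne γ) (W : ℂ → ℂ) (hW : IsWeightBranch α (k + β) (γ '' Ioo 0 1) W) :
    (∀ q ∈ polysDegreeLE (n - k - 1),
      HasContourIntegral γ (fun t => q.eval t * (jacobiPolynomial n α β).eval t * W t) 0) ∧
    (∀ q ∈ polysDegreeEq (n - k), ∃ L : ℂ, L ≠ 0 ∧
      HasContourIntegral γ (fun t => q.eval t * (jacobiPolynomial n α β).eval t * W t) L) := by
  lift k to ℕ using hk ▸ le_max_left _ _
  have hkβ : -1 < β + k := by
    have h1 : (⌊-β⌋ : ℝ) ≤ k := by exact_mod_cast (hk ▸ le_max_right _ _ : ⌊-β⌋ ≤ (k : ℤ))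
    linarith [Int.lt_floor_add_one (-β)]
  have hmem : ∀ s ∈ Ioo (0 : ℝ) 1, γ s ∈ raySlitPlane := fun s hs =>
    mem_raySlitPlane_iff.2 (hγ.avoids s hs)
  have hsub : γ '' Ioo 0 1 ⊆ raySlitPlane := by
    rintro _ ⟨s, hs, rfl⟩
    exact hmem s hs
  have hP := isLogPair_raySlitPlane
  obtain ⟨c, hc, hcW⟩ := hW.exists_eq_const_mul
    (isPreconnected_Ioo.image γ hγ.locallyAC.continuousOn) (hP.left_diff.continuousOn.mono hsub)
    (hP.right_diff.continuousOn.mono hsub) (fun z hz => hP.left_exp z (hsub hz))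
    (fun z hz => hP.right_exp z (hsub hz))
  obtain ⟨L, hL, hJ⟩ := exists_hasEndJump_raySlitPlane (a := α + n) (b := β + n) (by linarith)
    (add_nat_ne_int hα n) (fun j h => add_nat_ne_int hαβ (n + n) j (by push_cast; linarith))
  -- The branch has exponent `k + β`, so `q W` is a constant times `q (t+1)^k w(t;α,β)`. The
  -- integration by parts is applied to `q (X+1)^k`, whose degree exceeds that of a nonzero `q` by
  -- `k`.
  have key : ∀ q : ℂ[X], (q * (X + 1) ^ k).natDegree ≤ n →
      HasContourIntegral γ (fun t => q.eval t * (jacobiPolynomial n α β).eval t * W t)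
        (c * ((q * (X + 1) ^ k).coeff n / 2 ^ n * L)) := by
    intro q hq
    have hb : BoundaryTermsVanish rayLogLeft rayLogRight n α β (q * (X + 1) ^ k)
        (𝓝 (-1) ⊓ 𝓟 raySlitPlane) := hP.boundaryTermsVanish_neg_one hkβ (dvd_mul_left _ _)
    refine (hP.hasEndJump_mul_jacobiPolynomial hJ hq
      (hb.mono (nhdsWithin_neg_one_le fun z (hz : 0 < z.im) => hz.ne'))
      (hb.mono (nhdsWithin_neg_one_le fun z (hz : z.im < 0) => hz.ne))).hasContourIntegral
      hP.isOpen hγ.locallyAC hmem hγ.start hγ.finish fun z hz => ?_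
    have h1 := hP.logWeight_add_natCast_right (hsub hz) α β k
    have h2 : W z = c * ((z + 1) ^ k * logWeight rayLogLeft rayLogRight α β z) := by
      rw [hcW z hz, ← h1, logWeight]
      push_cast
      rw [add_comm (k : ℂ)]
    rw [h2]
    simp only [eval_mul, eval_pow, eval_add, eval_X, eval_one]
    ring
  have hmonic : ((X + 1 : ℂ[X]) ^ k).Monic := (monic_X_add_C (1 : ℂ)).pow k
  have hdeg : ((X + 1 : ℂ[X]) ^ k).natDegree = k := by
    have : (X + 1 : ℂ[X]).natDegree = 1 := natDegree_X_add_C (1 : ℂ)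
    rw [natDegree_pow, this, mul_one]
  refine ⟨fun q hq => ?_, fun q hq => ?_⟩
  · obtain ⟨h0, hq⟩ := hq
    have hlt : (q * (X + 1) ^ k).natDegree < n := by
      refine natDegree_mul_le.trans_lt ?_
      rw [hdeg]
      omega
    simpa [coeff_eq_zero_of_natDegree_lt hlt] using key q hlt.le
  · obtain ⟨h0, hq⟩ := hq
    have heq : (q * (X + 1) ^ k).natDegree = n := by
      rw [natDegree_mul h0 hmonic.ne_zero, hdeg]
      omega
    refine ⟨_, mul_ne_zero hc (mul_ne_zero (div_ne_zero ?_ (by simp)) hL), key q heq.le⟩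
    rw [← heq, coeff_natDegree]
    exact leadingCoeff_ne_zero.2 (mul_ne_zero h0 hmonic.ne_zero)

theorem IsGammaOne.neg {γ : ℝ → ℂ} (h : IsGammaOne γ) : IsGammaNegOne (fun s => -γ s) where
  locallyAC := fun a b ha hab hb => (h.locallyAC a b ha hab hb).neg
  avoids := fun s hs hn => h.avoids s hs
    ⟨by simpa using hn.1, by have := hn.2; rw [Complex.neg_re] at this; linarith⟩
  start := by
    have h1 := tendsto_nhdsWithin_iff.1 h.start
    refine tendsto_nhdsWithin_iff.2 ⟨h1.1.neg, ?_⟩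
    filter_upwards [h1.2] with s hs
    simpa using hs
  finish := by
    have h1 := tendsto_nhdsWithin_iff.1 h.finish
    refine tendsto_nhdsWithin_iff.2 ⟨h1.1.neg, ?_⟩
    filter_upwards [h1.2] with s hs
    simpa using hs

theorem IsWeightBranch.comp_neg {a b : ℂ} {S : Set ℂ} {W : ℂ → ℂ} (h : IsWeightBranch a b S W) :
    IsWeightBranch b a {z | -z ∈ S} (fun z => W (-z)) := by
  refine ⟨h.1.comp continuous_neg.continuousOn fun z hz => hz, fun z hz => ?_⟩
  obtain ⟨u, v, hu, hv, hW⟩ := h.2 _ hz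
  exact ⟨v, u, by rw [hv]; ring, by rw [hu]; ring, by simp only [hW, add_comm]⟩

theorem natDegree_comp_neg_X (q : ℂ[X]) : (q.comp (-X)).natDegree = q.natDegree := by
  rw [natDegree_comp, natDegree_neg, natDegree_X, mul_one]

theorem orthogonality_gammaOne (n : ℕ) (α β : ℝ) (hβ : ∀ j : ℤ, β ≠ j)
    (hαβ : ∀ j : ℤ, α + β ≠ j) (hn : -1 < n + α) (k : ℤ) (hk : k = max 0 ⌊-α⌋) (γ : ℝ → ℂ)
    (hγ : IsGammaOne γ) (W : ℂ → ℂ) (hW : IsWeightBranch (k + α) β (γ '' Ioo 0 1) W) :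
    (∀ q ∈ polysDegreeLE (n - k - 1),
      HasContourIntegral γ (fun t => q.eval t * (jacobiPolynomial n α β).eval t * W t) 0) ∧
    (∀ q ∈ polysDegreeEq (n - k), ∃ L : ℂ, L ≠ 0 ∧
      HasContourIntegral γ (fun t => q.eval t * (jacobiPolynomial n α β).eval t * W t) L) := by
  have hset : (fun s => -γ s) '' Ioo 0 1 ⊆ {z | -z ∈ γ '' Ioo 0 1} := by
    rintro _ ⟨s, hs, rfl⟩
    exact ⟨s, hs, (neg_neg _).symm⟩
  have hW' : IsWeightBranch β (k + α) ((fun s => -γ s) '' Ioo 0 1) (fun z => W (-z)) :=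
    ⟨hW.comp_neg.1.mono hset, fun z hz => hW.comp_neg.2 z (hset hz)⟩
  obtain ⟨h1, h2⟩ := orthogonality_gammaNegOne n β α hβ (fun j h => hαβ j
      (by rw [add_comm, h])) hn k
    hk _ hγ.neg _ hW'
  have key : ∀ (q : ℂ[X]) (L : ℂ), HasContourIntegral (fun s => -γ s)
      (fun t => (C ((-1) ^ n) * q.comp (-X)).eval t * (jacobiPolynomial n β α).eval t * W (-t)) L →
      HasContourIntegral γ (fun t => q.eval t * (jacobiPolynomial n α β).eval t * W t) (-L) := by
    intro q L h
    refine (h.congr fun z _ => ?_).of_neg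
    rw [jacobiPolynomial_eval_neg n β α z]
    simp only [eval_mul, eval_C, eval_comp, eval_neg, eval_X]
    ring
  have hunit : ((-1 : ℂ) ^ n) ≠ 0 := by simp
  have hnat : ∀ q : ℂ[X], (C ((-1 : ℂ) ^ n) * q.comp (-X)).natDegree = q.natDegree := fun q => by
    rw [natDegree_C_mul hunit, natDegree_comp_neg_X]
  refine ⟨fun q hq => ?_, fun q hq => ?_⟩
  · simpa using key q 0 (h1 _ ⟨hq.1, by rw [hnat]; exact hq.2⟩)
  · have hne : C ((-1 : ℂ) ^ n) * q.comp (-X) ≠ 0 := by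
      refine mul_ne_zero (C_ne_zero.2 hunit) fun h => hq.1 ?_
      have := congrArg (fun p : ℂ[X] => p.comp (-X)) h
      simpa [comp_assoc] using this
    obtain ⟨L, hL, h⟩ := h2 _ ⟨hne, by rw [hnat]; exact hq.2⟩
    exact ⟨-L, neg_ne_zero.2 hL, key q L h⟩

theorem IsGammaInfty.tendsto_start {γ : ℝ → ℂ} (hγ : IsGammaInfty γ) :
    Tendsto γ (𝓝[>] 0) (halfInfty 1) := by
  refine tendsto_inf.2 ⟨?_, tendsto_principal.2 ?_⟩
  · rw [← tendsto_norm_atTop_iff_cobounded]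
    exact tendsto_atTop_mono (fun s => (le_abs_self _).trans (Complex.abs_im_le_norm _)) hγ.start
  · filter_upwards [hγ.start.eventually_gt_atTop 0] with s hs
    simpa using hs

theorem IsGammaInfty.tendsto_finish {γ : ℝ → ℂ} (hγ : IsGammaInfty γ) :
    Tendsto γ (𝓝[<] 1) (halfInfty (-1)) := by
  refine tendsto_inf.2 ⟨?_, tendsto_principal.2 ?_⟩
  · rw [← tendsto_norm_atTop_iff_cobounded]
    exact tendsto_atTop_mono (fun s => (neg_le_abs _).trans (Complex.abs_im_le_norm _))
      (tendsto_neg_atBot_atTop.comp hγ.finish)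
  · filter_upwards [hγ.finish.eventually_lt_atBot 0] with s hs
    simpa using hs

theorem orthogonality_gammaInfty (n : ℕ) (α β : ℝ) (hα : ∀ j : ℤ, α ≠ j) (hβ : ∀ j : ℤ, β ≠ j)
    (hαβ : ∀ j : ℤ, α + β ≠ j) (γ : ℝ → ℂ) (hγ : IsGammaInfty γ) (W : ℂ → ℂ)
    (hW : IsWeightBranch α β (γ '' Ioo 0 1) W) :
    (∀ m : ℤ, m = min ((n : ℤ) - 1) ⌊-(n + α + β + 1)⌋ → ∀ q ∈ polysDegreeLE m,
      HasContourIntegral γ (fun t => q.eval t * (jacobiPolynomial n α β).eval t * W t) 0) ∧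
    (n + α + β < -n - 1 → ∀ q ∈ polysDegreeEq n, ∃ L : ℂ, L ≠ 0 ∧
      HasContourIntegral γ (fun t => q.eval t * (jacobiPolynomial n α β).eval t * W t) L) := by
  have hmem : ∀ s ∈ Ioo (0 : ℝ) 1, γ s ∈ doubleSlitPlane := fun s hs =>
    mem_doubleSlitPlane_iff.2 (hγ.avoids s hs)
  have hsub : γ '' Ioo 0 1 ⊆ doubleSlitPlane := by
    rintro _ ⟨s, hs, rfl⟩
    exact hmem s hs
  have hP := isLogPair_doubleSlitPlane
  obtain ⟨c, hc, hcW⟩ := hW.exists_eq_const_mul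
    (isPreconnected_Ioo.image γ hγ.locallyAC.continuousOn) (hP.left_diff.continuousOn.mono hsub)
    (hP.right_diff.continuousOn.mono hsub) (fun z hz => hP.left_exp z (hsub hz))
    (fun z hz => hP.right_exp z (hsub hz))
  have hcurve : ∀ (q : ℂ[X]) (L : ℂ), HasEndJump doubleSlitPlane (halfInfty 1) (halfInfty (-1))
      (fun z => q.eval z * (jacobiPolynomial n α β).eval z * stripWeight α β z) L →
      HasContourIntegral γ (fun t => q.eval t * (jacobiPolynomial n α β).eval t * W t) (c * L) := by
    intro q L h
    refine h.hasContourIntegral hP.isOpen hγ.locallyAC hmem hγ.tendsto_start hγ.tendsto_finish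
      fun z hz => ?_
    rw [hcW z hz, stripWeight, logWeight]
    ring
  refine ⟨fun m hm q hq => ?_, fun hn q hq => ?_⟩
  · obtain ⟨h0, hq⟩ := hq
    have h1 : (q.natDegree : ℤ) ≤ n - 1 := by rw [hm] at hq; exact hq.trans (min_le_left _ _)
    have h2 : (q.natDegree : ℝ) ≤ -(n + α + β + 1) := by
      have : (q.natDegree : ℤ) ≤ ⌊-(n + α + β + 1)⌋ := by
        rw [hm] at hq; exact hq.trans (min_le_right _ _)
      exact_mod_cast Int.le_floor.1 this
    -- The floor gives only `≤ 0`; equality would make `α + β` an integer.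
    have h3 : (q.natDegree : ℝ) + n + 1 + α + β < 0 := by
      refine lt_of_le_of_ne (by linarith) fun h => hαβ (-(q.natDegree + n + 1)) ?_
      push_cast
      linarith
    have hb := hP.boundaryTermsVanish_cobounded h3
    obtain ⟨F, hF⟩ := exists_primitive_stripWeight (α + n) (β + n)
    have := hcurve q 0 (hP.hasEndJump_mul_jacobiPolynomial_zero hF (by omega)
      (hb.mono (halfInfty_le_cobounded_inf 1)) (hb.mono (halfInfty_le_cobounded_inf (-1))))
    rwa [mul_zero] at this
  · obtain ⟨h0, hq⟩ := hq
    have hq' : q.natDegree = n := by exact_mod_cast hq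
    -- For degree `n`, the inequality `2n + 1 + α + β < 0` serves twice: it kills the boundary terms
    -- and makes the integral of `w(α+n,β+n)` converge.
    have hb := hP.boundaryTermsVanish_cobounded (q := q) (n := n) (α := α) (β := β)
      (by rw [hq']; linarith)
    obtain ⟨L, hL, hJ⟩ := exists_hasStripJump_ne_zero (a := α + n) (b := β + n) (by linarith)
      (add_nat_ne_int hα n) (add_nat_ne_int hβ n)
    refine ⟨_, mul_ne_zero hc (mul_ne_zero (div_ne_zero ?_ (by simp)) hL),
      hcurve q _ (hP.hasEndJump_mul_jacobiPolynomial hJ hq'.le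
        (hb.mono (halfInfty_le_cobounded_inf 1)) (hb.mono (halfInfty_le_cobounded_inf (-1))))⟩
    rw [← hq', coeff_natDegree]
    exact leadingCoeff_ne_zero.2 h0

theorem theorem4p1 (n : ℕ) (α β : ℝ)
    (hα : ∀ j : ℤ, α ≠ j) (hβ : ∀ j : ℤ, β ≠ j) (hαβ : ∀ j : ℤ, α + β ≠ j) :
    -- (i) orthogonality on the loops based at `-1`
    (-1 < n + β → ∀ k : ℤ, k = max 0 ⌊-β⌋ →
      ∀ γ : ℝ → ℂ, IsGammaNegOne γ →
      ∀ W : ℂ → ℂ, IsWeightBranch α (k + β) (γ '' Ioo 0 1) W →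
        (∀ q ∈ polysDegreeLE (n - k - 1),
          HasContourIntegral γ (fun t => q.eval t * (jacobiPolynomial n α β).eval t * W t) 0) ∧
        (∀ q ∈ polysDegreeEq (n - k), ∃ L : ℂ, L ≠ 0 ∧
          HasContourIntegral γ (fun t => q.eval t * (jacobiPolynomial n α β).eval t * W t) L)) ∧
    -- (ii) orthogonality on the loops based at `1`
    (-1 < n + α → ∀ k : ℤ, k = max 0 ⌊-α⌋ →
      ∀ γ : ℝ → ℂ, IsGammaOne γ →
      ∀ W : ℂ → ℂ, IsWeightBranch (k + α) β (γ '' Ioo 0 1) W →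
        (∀ q ∈ polysDegreeLE (n - k - 1),
          HasContourIntegral γ (fun t => q.eval t * (jacobiPolynomial n α β).eval t * W t) 0) ∧
        (∀ q ∈ polysDegreeEq (n - k), ∃ L : ℂ, L ≠ 0 ∧
          HasContourIntegral γ (fun t => q.eval t * (jacobiPolynomial n α β).eval t * W t) L)) ∧
    -- (iii) orthogonality on the curves from `+i∞` to `-i∞`
    (n + α + β < -1 →
      ∀ γ : ℝ → ℂ, IsGammaInfty γ →
      ∀ W : ℂ → ℂ, IsWeightBranch α β (γ '' Ioo 0 1) W →
        (∀ m : ℤ, m = min ((n : ℤ) - 1) ⌊-(n + α + β + 1)⌋ → ∀ q ∈ polysDegreeLE m,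
          HasContourIntegral γ (fun t => q.eval t * (jacobiPolynomial n α β).eval t * W t) 0) ∧
        (n + α + β < -n - 1 →
          (∀ q ∈ polysDegreeLE (n - 1),
            HasContourIntegral γ
              (fun t => q.eval t * (jacobiPolynomial n α β).eval t * W t) 0) ∧
          (∀ q ∈ polysDegreeEq n, ∃ L : ℂ, L ≠ 0 ∧
            HasContourIntegral γ
              (fun t => q.eval t * (jacobiPolynomial n α β).eval t * W t) L))) := by
  refine ⟨orthogonality_gammaNegOne n α β hα hαβ, orthogonality_gammaOne n α β hβ hαβ,
    fun _ γ hγ W hW => ?_⟩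
  obtain ⟨h1, h2⟩ := orthogonality_gammaInfty n α β hα hβ hαβ γ hγ W hW
  refine ⟨h1, fun hn => ⟨h1 (n - 1) ?_, h2 hn⟩⟩
  -- Under the stronger inequality the floor is at least `n - 1`, so the minimum is `n - 1`.
  refine (min_eq_left (Int.le_floor.2 ?_)).symm
  push_cast
  linarith
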